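/- **Setting.** Let $\Gamma=\partial\Omega$ be described near a boundary point $O$ by local coordinates $(n,\tau)$, $\tau=(\tau_1,\tau_2)$, with $\Gamma=\{n=0\}$ and the exterior of $\Omega$ given by $n>0$. For $u$ with values in $\mathbb R^N$ consider the system $$-\frac{\partial^2u}{\partial t^2}+A\frac{\partial^2u}{\partial n^2}+\sum_{i}B_i\frac{\partial^2u}{\partial\tau_i\partial n}+C\frac{\partial u}{\partial n}+\sum_{i,j}a_{ij}\frac{\partial^2u}{\partial\tau_i\partial\tau_j}+\sum_ic_i\frac{\partial u}{\partial\tau_i}+du=0\qquad(2)$$ with real $N\times N$ coefficients, $A,B_i$ depending on $\tau$ and $C,a_{ij},c_i,d$ on $(n,\tau)$, all smooth at $O$; put $C_0=C|_{n=0}$. Assume that (2) is hyperbolic at $O$: for all real $(\xi_n,\xi_1,\xi_2)$ of norm $1$ the equation $\det(-\lambda^2I+A\xi_n^2+\sum_iB_i\xi_i\xi_n+\sum_{i,j}a_{ij}\xi_i\xi_j)=0$ at $O$ has $2N$ different real roots $\lambda$. An *outgoing high-frequency family* near $O$ is a family $\hat u(s;n,\tau)$ of $C^2$ functions ($s$ large,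 $|n|<\delta$, $\tau$ in a neighbourhood $W$ of $O$ in the tangent plane) such that, with $\varepsilon=1/s$ and $\tilde u(\eta,\tau,\varepsilon)=\hat u(1/\varepsilon;\varepsilon\eta,\tau)$: (a) $\tilde u=v+\varepsilon w+o(\varepsilon)$ as $\varepsilon\to+0$, for each $\eta\ge0$ and $\tau\in W$, with $C^2$ profiles $v(\eta,\tau),w(\eta,\tau)$, and this expansion may be differentiated term by term up to second order; (b) $v,w\to0$ as $\eta\to+\infty$. It is a *family of solutions* if, for each $\eta\ge 0$ and $\tau\in W$, $\tilde u$ satisfies the Laplace-transformed system (that is, (2) with $-\partial^2u/\partial t^2$ replaced by $-s^2\hat u$), multiplied by $\varepsilon^2$ and written in $(\eta,\tau)$, up to $o(\varepsilon)$; exact solutions are included. For tangential operators $P_1,P_0$ at $O$ of order at most one, i.e. of the form $P\varphi=p\,\varphi(O)+\sum_iq_i\,\partial_{\tau_i}\varphi(O)$ with $N\times N$ matrices $p,q_i$, call $P_1\frac{\partial}{\partial t}-\frac{\partial}{\partial n}+P_0$ the *differential part of the transparent boundary conditions* for (2) at $O$ if $$sP_1\hat u|_{n=0}-\frac{\partial\hat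 u}{\partial n}\Big|_{n=0}+P_0\hat u|_{n=0}=o(s^0),\qquad s\to\infty,\quad\text{at }O,$$ for every outgoing high-frequency family of solutions (so $sP_1+P_0$ is the Poincaré–Steklov operator up to $o(s^0)$). **Theorem.** All eigenvalues of $A(O)$ are real and positive. For $\tau$ near $O$ there is exactly one matrix $A^{-1/2}(\tau)$ with positive eigenvalues whose square is $A(\tau)^{-1}$, and it is smooth at $O$. There is exactly one tangential operator $P_0=p+\sum_iq_i\partial_{\tau_i}$ at $O$ that satisfies the Sylvester equation $$A^{-1/2}P_0+P_0A^{-1/2}=-A^{-1}\big((B\nabla_\tau A^{-1/2})+(BA^{-1/2}\nabla_\tau)+C_0A^{-1/2}\big),$$ understood as an equality of operators on smooth functions of $\tau$ at $O$, where $(B\nabla_\tau A^{-1/2})=\sum_iB_i\,\partial_{\tau_i}(A^{-1/2})$ and $(BA^{-1/2}\nabla_\tau)=\sum_iB_iA^{-1/2}\partial_{\tau_i}$. The expression $$P_1\frac{\partial u}{\partial t}-\frac{\partial u}{\partial n}+P_0u$$ is the differential part of the transparent boundary conditions for (2) at $O$ if and only if $P_1=-A^{-1/2}(O)$ and $P_0$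 is the solution of this Sylvester equation. Moreover, for these $P_1,P_0$ the condition holds in the time domain: let $u(t,n,\tau)$ be $C^2$ for $|n|<\delta$, $\tau\in W$, solve (2) for $t>0$, $0\le n<\delta$, satisfy $u=\partial u/\partial t=0$ at $t=0$ for $0\le n<\delta$, and grow, together with its derivatives of order at most two, at most like $Ke^{s_0t}$ for $t\ge0$, uniformly in $(n,\tau)$. If for some scalar amplitude $\sigma(s)$ the family $\sigma(s)\hat u(s;n,\tau)$, $\hat u$ the Laplace transform of $u$ in time, is an outgoing high-frequency family, then the Laplace transform of $P_1\frac{\partial u}{\partial t}-\frac{\partial u}{\partial n}+P_0u$ at $O$ converges for large $s$ and, multiplied by $\sigma(s)$, tends to $0$ as $s\to\infty$. -/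

import Mathlib

open Set Filter Topology MeasureTheory Asymptotics
open scoped ContDiff Matrix

noncomputable section

namespace TBC

/-- Values `u ∈ ℝ^N` of the unknown vector function. -/
abbrev Vec (N : ℕ) := Fin N → ℝ

/-- Real `N × N` matrices. -/
abbrev Mat (N : ℕ) := Matrix (Fin N) (Fin N) ℝ

/-- The tangential variables `τ = (τ₁, τ₂)`. -/
abbrev Tan := Fin 2 → ℝ

/-- Local coordinates `(n, τ)`. The boundary `Γ` is `n = 0`, the exterior of `Ω` is `n > 0`. -/
abbrev Loc := ℝ × Tan

/-- The `i`-th tangential coordinate vector. -/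
def tanDir (i : Fin 2) : Tan := Pi.single i 1

/-- Directional derivative `∂_e f` of a function of `(n, τ)` (or of `(η, τ)`). -/
def pd {N : ℕ} (e : Loc) (f : Loc → Vec N) : Loc → Vec N := fun x => fderiv ℝ f x e

/-- Normal derivative `∂f/∂n` (or `∂f/∂η`). -/
def dN {N : ℕ} (f : Loc → Vec N) : Loc → Vec N := pd (1, 0) f

/-- Tangential derivative `∂f/∂τᵢ`. -/
def dT {N : ℕ} (i : Fin 2) (f : Loc → Vec N) : Loc → Vec N := pd (0, tanDir i) f

/-- Entrywise derivative `∂M/∂τᵢ` of a matrix function of `τ`. -/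
def dMat {N : ℕ} (i : Fin 2) (M : Tan → Mat N) (τ : Tan) : Mat N :=
  Matrix.of fun j k => fderiv ℝ (fun τ' => M τ' j k) τ (tanDir i)

/-- A matrix function has entries that are smooth at `x`. -/
def SmoothMatAt {E : Type*} [NormedAddCommGroup E] [NormedSpace ℝ E] {N : ℕ}
    (M : E → Mat N) (x : E) : Prop :=
  ∀ j k, ContDiffAt ℝ ∞ (fun y => M y j k) x

/-- The coefficients of the second-order system
`-u_tt + A u_nn + (B∇_τ) u_n + C u_n + a(∇_τ, ∇_τ) u + (c∇_τ) u + d u = 0`;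
`A` and `B` depend on `τ` only, the other ones on `(n, τ)`. -/
structure SecondOrderSystem (N : ℕ) where
  A : Tan → Mat N
  B : Fin 2 → Tan → Mat N
  C : Loc → Mat N
  a : Fin 2 → Fin 2 → Loc → Mat N
  c : Fin 2 → Loc → Mat N
  d : Loc → Mat N

variable {N : ℕ}

/-- All coefficients are smooth at the boundary point `(0, O)`. -/
def SecondOrderSystem.SmoothAt (sys : SecondOrderSystem N) (O : Tan) : Prop :=
  SmoothMatAt sys.A O ∧ (∀ i, SmoothMatAt (sys.B i) O) ∧ SmoothMatAt sys.C (0, O) ∧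
    (∀ i j, SmoothMatAt (sys.a i j) (0, O)) ∧ (∀ i, SmoothMatAt (sys.c i) (0, O)) ∧
    SmoothMatAt sys.d (0, O)

/-- The characteristic determinant `Q(λ, ξ_n, ξ_1, ξ_2)` at the boundary point `(0, O)`. -/
def SecondOrderSystem.charDet (sys : SecondOrderSystem N) (O : Tan) (l ξn : ℝ) (ξ : Tan) : ℝ :=
  (-(l ^ 2 • (1 : Mat N)) + ξn ^ 2 • sys.A O + (∑ i, (ξ i * ξn) • sys.B i O) +
    ∑ i, ∑ j, (ξ i * ξ j) • sys.a i j (0, O)).det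

/-- Hyperbolicity at `(0, O)`: for each real unit covector, `Q = 0` has `2N` different
real roots `λ`. -/
def SecondOrderSystem.HyperbolicAt (sys : SecondOrderSystem N) (O : Tan) : Prop :=
  ∀ (ξn : ℝ) (ξ : Tan), ξn ^ 2 + ∑ i, ξ i ^ 2 = 1 →
    {l : ℝ | sys.charDet O l ξn ξ = 0}.ncard = 2 * N

/-- The terms of the system without time derivatives. -/
def SecondOrderSystem.spatialOp (sys : SecondOrderSystem N) (f : Loc → Vec N) (x : Loc) : Vec N :=
  sys.A x.2 *ᵥ dN (dN f) x + (∑ i, sys.B i x.2 *ᵥ dT i (dN f) x) + sys.C x *ᵥ dN f x +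
    (∑ i, ∑ j, sys.a i j x *ᵥ dT i (dT j f) x) + (∑ i, sys.c i x *ᵥ dT i f x) + sys.d x *ᵥ f x

/-- The left-hand side of the system after the Laplace transform in time. -/
def SecondOrderSystem.laplaceOp (sys : SecondOrderSystem N) (s : ℝ) (f : Loc → Vec N)
    (x : Loc) : Vec N :=
  -(s ^ 2 • f x) + sys.spatialOp f x

/-- All complex eigenvalues of `M` are real and positive. -/
def PosEigenvalues (M : Mat N) : Prop :=
  ∀ z ∈ spectrum ℂ (M.map (algebraMap ℝ ℂ)), z.im = 0 ∧ 0 < z.re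

/-- `S = A^{-1/2}`, the positive square root of `A⁻¹`. -/
def IsInvSqrt (A S : Mat N) : Prop := S * S * A = 1 ∧ PosEigenvalues S

/-- A tangential differential operator `p + (q∇_τ)` of order at most one at a boundary point,
given by its coefficient matrices at that point. -/
@[ext] structure TanOp (N : ℕ) where
  p : Mat N
  q : Fin 2 → Mat N

/-- The value at `O` of `p φ + (q∇_τ) φ`. -/
def TanOp.app (P : TanOp N) (φ : Tan → Vec N) (O : Tan) : Vec N :=
  P.p *ᵥ φ O + ∑ i, P.q i *ᵥ fderiv ℝ φ O (tanDir i)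

/-- The operator of multiplication by a matrix. -/
def TanOp.ofMat (M : Mat N) : TanOp N := ⟨M, fun _ => 0⟩

/-- The Sylvester equation
`S P₀ + P₀ S = -A⁻¹ ((B∇_τ S) + (B S ∇_τ) + C₀ S)`
as an equality of operators at `O`, i.e. applied to every smooth `φ` and evaluated at `O`. -/
def SolvesSylvester (sys : SecondOrderSystem N) (S : Tan → Mat N) (O : Tan) (P₀ : TanOp N) : Prop :=
  ∀ φ : Tan → Vec N, ContDiffAt ℝ ∞ φ O →
    S O *ᵥ P₀.app φ O + P₀.app (fun τ => S τ *ᵥ φ τ) O =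
      -((sys.A O)⁻¹ *ᵥ ((∑ i, (sys.B i O * dMat i S O) *ᵥ φ O) +
        (∑ i, (sys.B i O * S O) *ᵥ fderiv ℝ φ O (tanDir i)) + (sys.C (0, O) * S O) *ᵥ φ O))

/-- The family `û(s; n, τ)` in the variables `ε = 1/s`, `η = n/ε`:
`ũ(η, τ, ε) = û(1/ε; εη, τ)`. -/
def rescale (U : ℝ → Loc → Vec N) (ε : ℝ) : Loc → Vec N := fun y => U (1 / ε) (ε * y.1, y.2)

/-- The family `û` is twice continuously differentiable on `(-δ, δ) × W` and has a linear
high-frequency expansion `ũ = v + ε w + o(ε)`, `ε → +0`, that may be differentiated twice term by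
term, with profiles that vanish as `η → +∞` (waves leaving `Ω`). -/
structure HasOutgoingExpansion (δ : ℝ) (W : Set Tan) (U : ℝ → Loc → Vec N)
    (v w : Loc → Vec N) : Prop where
  smooth : ∀ᶠ s in atTop, ContDiffOn ℝ 2 (U s) (Ioo (-δ) δ ×ˢ W)
  smooth_v : ContDiffOn ℝ 2 v (univ ×ˢ W)
  smooth_w : ContDiffOn ℝ 2 w (univ ×ˢ W)
  expand : ∀ η : ℝ, 0 ≤ η → ∀ τ ∈ W,
    (fun ε => rescale U ε (η, τ) - v (η, τ) - ε • w (η, τ)) =o[𝓝[>] 0] fun ε : ℝ => ε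
  expand_pd : ∀ e : Loc, ∀ η : ℝ, 0 ≤ η → ∀ τ ∈ W,
    (fun ε => pd e (rescale U ε) (η, τ) - pd e v (η, τ) - ε • pd e w (η, τ))
      =o[𝓝[>] 0] fun ε : ℝ => ε
  expand_pd_pd : ∀ e e' : Loc, ∀ η : ℝ, 0 ≤ η → ∀ τ ∈ W,
    (fun ε => pd e (pd e' (rescale U ε)) (η, τ) - pd e (pd e' v) (η, τ) -
      ε • pd e (pd e' w) (η, τ)) =o[𝓝[>] 0] fun ε : ℝ => ε
  vanish_v : ∀ τ ∈ W, Tendsto (fun η => v (η, τ)) atTop (𝓝 0)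
  vanish_w : ∀ τ ∈ W, Tendsto (fun η => w (η, τ)) atTop (𝓝 0)

/-- In the variables `(η, τ)`, on the exterior side, the family satisfies the Laplace-transformed
system (multiplied by `ε²`) up to `o(ε)`. Exact solutions are a special case. -/
def SolvesUpToFirstOrder (sys : SecondOrderSystem N) (W : Set Tan) (U : ℝ → Loc → Vec N) : Prop :=
  ∀ η : ℝ, 0 ≤ η → ∀ τ ∈ W,
    (fun ε => ε ^ 2 • sys.laplaceOp (1 / ε) (U (1 / ε)) (ε * η, τ)) =o[𝓝[>] 0] fun ε : ℝ => ε

/-- `P₁ ∂/∂t - ∂/∂n + P₀` is the differential part of the transparent boundary conditions at `O`: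
its Laplace symbol `s P₁ - ∂/∂n + P₀` annihilates, up to `o(s⁰)` as `s → ∞`, the boundary data of
each outgoing high-frequency family of solutions; in other words `s P₁ + P₀` is the Poincaré-Steklov
operator `û|_{n=0} ↦ ∂û/∂n|_{n=0}` up to `o(s⁰)`. -/
def IsDifferentialPart (sys : SecondOrderSystem N) (O : Tan) (P₁ P₀ : TanOp N) : Prop :=
  ∀ (δ : ℝ) (W : Set Tan) (U : ℝ → Loc → Vec N) (v w : Loc → Vec N),
    0 < δ → IsOpen W → O ∈ W → HasOutgoingExpansion δ W U v w → SolvesUpToFirstOrder sys W U →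
    Tendsto (fun s => s • P₁.app (fun τ => U s (0, τ)) O - dN (U s) (0, O) +
      P₀.app (fun τ => U s (0, τ)) O) atTop (𝓝 0)

/-- A twice continuously differentiable `u(t; n, τ)` near the boundary point that solves the system
on the exterior side for `t > 0`, is at rest there at `t = 0`, and grows at most exponentially in
time together with its derivatives of order at most two. -/
structure IsTimeSolution (sys : SecondOrderSystem N) (δ : ℝ) (W : Set Tan)
    (u : ℝ → Loc → Vec N) : Prop where
  smooth : ContDiffOn ℝ 2 (fun z : ℝ × Loc => u z.1 z.2) (univ ×ˢ (Ioo (-δ) δ ×ˢ W))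
  growth : ∃ K s₀ : ℝ, ∀ t : ℝ, 0 ≤ t → ∀ x ∈ Ioo (-δ) δ ×ˢ W, ∀ k ≤ 2,
    ‖iteratedFDeriv ℝ k (fun z : ℝ × Loc => u z.1 z.2) (t, x)‖ ≤ K * Real.exp (s₀ * t)
  eqn : ∀ t : ℝ, 0 < t → ∀ x ∈ Ico 0 δ ×ˢ W,
    -iteratedDeriv 2 (fun t' => u t' x) t + sys.spatialOp (u t) x = 0
  rest : ∀ x ∈ Ico 0 δ ×ˢ W, u 0 x = 0 ∧ deriv (fun t => u t x) 0 = 0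

/-- The Laplace transform `∫₀^∞ e^{-st} f(t) dt` at a real `s`. -/
def laplace (f : ℝ → Vec N) (s : ℝ) : Vec N := ∫ t in Ioi (0 : ℝ), Real.exp (-(s * t)) • f t

/-- `(P₁ ∂u/∂t - ∂u/∂n + P₀ u)(t)` at the boundary point `(0, O)`. -/
def boundaryOp (P₁ P₀ : TanOp N) (O : Tan) (u : ℝ → Loc → Vec N) (t : ℝ) : Vec N :=
  P₁.app (fun τ => deriv (fun t' => u t' (0, τ)) t) O - dN (u t) (0, O) +
    P₀.app (fun τ => u t (0, τ)) O

/-- In the time domain: whenever the Laplace transform of a solution that starts from rest has,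
after normalization by some amplitude `σ(s)`, an outgoing high-frequency expansion, the Laplace
transform of `P₁ ∂u/∂t - ∂u/∂n + P₀ u` at `(0, O)` (which converges for large `s`) is
`o(1)` as `s → ∞` in the same normalization. -/
def HoldsInTimeDomain (sys : SecondOrderSystem N) (O : Tan) (P₁ P₀ : TanOp N) : Prop :=
  ∀ (δ : ℝ) (W : Set Tan) (u : ℝ → Loc → Vec N) (σ : ℝ → ℝ) (v w : Loc → Vec N),
    0 < δ → IsOpen W → O ∈ W → IsTimeSolution sys δ W u →
    HasOutgoingExpansion δ W (fun s x => σ s • laplace (fun t => u t x) s) v w →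
    (∀ᶠ s in atTop, IntegrableOn (fun t => Real.exp (-(s * t)) • boundaryOp P₁ P₀ O u t)
      (Ioi 0)) ∧
    Tendsto (fun s => σ s • laplace (boundaryOp P₁ P₀ O u) s) atTop (𝓝 0)

end TBC

end

/-!
The system is studied through the profiles of an outgoing family. In the variables
`η = n / ε`, `ε = 1 / s`, the transformed operator is `-1 + A ∂_η²` plus `ε` times
`(B∇_τ) ∂_η + C` plus terms of order `ε²`, so a family with the expansion `v + ε w + o(ε)` solves the
system up to `o(ε)` exactly when `A v_ηη = v` and
`A w_ηη = w - (B∇_τ) v_η - C₀ v_η` (`HasOutgoingExpansion.isLittleO_laplaceOp_iff`). Likewise the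
boundary symbol `s P₁ - ∂_n + P₀` tends to zero exactly when `P₁ v = v_η` and
`P₁ w - w_η + P₀ v = 0` at `η = 0` (`HasOutgoingExpansion.tendsto_symbol_iff`).

Hyperbolicity in the conormal direction gives `A(O)` exactly `N` different positive eigenvalues.
Hence `S = A^{-1/2}` exists near `O`, is smooth by the inverse function theorem for `X ↦ X²`, and
keeps `N` different positive eigenvalues (`exists_smooth_invSqrt`). The Sylvester operator
`Z ↦ S Z + Z S` is then bijective; this also gives the uniqueness of the square root and of `P₀`.

For the sufficiency, `z = v_η + S v` satisfies `z_η = S z`, so it grows exponentially unless it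
vanishes, and decay of `v` forces `v_η = -S v`. Then the tangential derivatives of `v` decay as well,
and the Sylvester equation is precisely what makes `z = w_η + S w - P₀ v` satisfy `z_η = S z`; again
`z = 0` (`HasSimplePosSpectrum.residual_eq_zero`, `dN_eq_of_order1`).

For the necessity, `(v, ∂_τ v, w)` with `v_η = -S v`, `w_η = -S w + P₀ v` and arbitrary boundary
values `v = φ`, `w = 0` is the exponential flow of a linear system that depends smoothly on `τ`, which
produces enough outgoing families to determine `P₁` and `P₀` (`exists_outgoing_solution`).

In the time domain the Laplace transform of a solution at rest for `t = 0` solves the transformed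
system exactly, by differentiation under the integral and integration by parts, and the transform of
the boundary expression is the boundary symbol (`IsTimeSolution.exists_laplace`).
-/

namespace TBC

variable {N : ℕ}

/-! ### Matrices with simple positive spectrum -/

/-- The `N × N` matrix `M` has `N` different positive eigenvalues `μ j`. The rows of `Q` are left
eigenvectors, `R` is the inverse of `Q`. -/
def HasSimplePosSpectrum (M : Mat N) : Prop :=
  ∃ (Q R : Mat N) (μ : Fin N → ℝ), R * Q = 1 ∧ Q * M = Matrix.diagonal μ * Q ∧
    Function.Injective μ ∧ ∀ j, 0 < μ j

lemma hasSimplePosSpectrum_of_det_eq_zero {M : Mat N} {μ : Fin N → ℝ}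
    (hinj : Function.Injective μ) (hpos : ∀ j, 0 < μ j)
    (hdet : ∀ j, (M - μ j • (1 : Mat N)).det = 0) : HasSimplePosSpectrum M := by
  have h1 : ∀ j, ∃ v : Vec N, v ≠ 0 ∧ v ᵥ* M = μ j • v := by
    intro j
    obtain ⟨v, hv, hv'⟩ := Matrix.exists_vecMul_eq_zero_iff.2 (hdet j)
    refine ⟨v, hv, ?_⟩
    rw [Matrix.vecMul_sub, Matrix.vecMul_smul, Matrix.vecMul_one, sub_eq_zero] at hv'
    exact hv'
  choose v hv0 hv using h1
  have hli : LinearIndependent ℝ v := by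
    refine Module.End.eigenvectors_linearIndependent' (Matrix.vecMulLinear M) μ hinj v fun j => ?_
    rw [Module.End.hasEigenvector_iff, Module.End.mem_eigenspace_iff]
    exact ⟨hv j, hv0 j⟩
  have hu : IsUnit (Matrix.of v) := Matrix.linearIndependent_rows_iff_isUnit.1 hli
  have hu' : IsUnit (Matrix.of v).det := (Matrix.isUnit_iff_isUnit_det _).1 hu
  refine ⟨Matrix.of v, (Matrix.of v)⁻¹, μ, Matrix.nonsing_inv_mul _ hu', ?_, hinj, hpos⟩
  ext i k
  have := congrFun (hv i) k
  rw [Matrix.diagonal_mul]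
  simpa [Matrix.mul_apply, Matrix.vecMul, dotProduct] using this

lemma det_smul_one_sub_of_diagonalized {M Q R : Mat N} {μ : Fin N → ℝ} (hRQ : R * Q = 1)
    (hQ : Q * M = Matrix.diagonal μ * Q) (x : ℝ) :
    (x • (1 : Mat N) - M).det = ∏ j, (x - μ j) := by
  have h : x • (1 : Mat N) - M = R * Matrix.diagonal (fun j => x - μ j) * Q := by
    have : Matrix.diagonal (fun j => x - μ j) = x • (1 : Mat N) - Matrix.diagonal μ := by
      ext i j
      by_cases hij : i = j
      · subst hij; simp
      · simp [hij]
    rw [this, mul_assoc, sub_mul, ← hQ, mul_sub, ← mul_assoc R Q, hRQ, smul_mul_assoc, one_mul,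
      one_mul, mul_smul_comm, hRQ]
  have h2 : R.det * Q.det = 1 := by rw [← Matrix.det_mul, hRQ, Matrix.det_one]
  rw [h, Matrix.det_mul, Matrix.det_mul, Matrix.det_diagonal]
  linear_combination (∏ j, (x - μ j)) * h2

lemma HasSimplePosSpectrum.posEigenvalues {M : Mat N} (hM : HasSimplePosSpectrum M) :
    PosEigenvalues M := by
  obtain ⟨Q, R, μ, hRQ, hQ, -, hpos⟩ := hM
  intro z hz
  have hcp : M.charpoly = ∏ j, (Polynomial.X - Polynomial.C (μ j)) := by
    refine Polynomial.funext fun x => ?_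
    rw [Matrix.eval_charpoly, Polynomial.eval_prod, Matrix.scalar_apply,
      ← Matrix.smul_one_eq_diagonal]
    simpa using det_smul_one_sub_of_diagonalized hRQ hQ x
  rw [Matrix.mem_spectrum_iff_isRoot_charpoly, Matrix.charpoly_map, hcp, Polynomial.IsRoot.def,
    Polynomial.eval_map, Polynomial.eval₂_finsetProd, Finset.prod_eq_zero_iff] at hz
  obtain ⟨j, -, hj⟩ := hz
  have : z = (μ j : ℂ) := by simpa [sub_eq_zero] using hj
  simp [this, hpos j]

/-- A real matrix whose complex spectrum is positive has no negative real eigenvalue. -/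
lemma PosEigenvalues.eq_zero_of_mulVec_eq {X : Mat N} (hX : PosEigenvalues X) {v : Vec N} {c : ℝ}
    (hc : 0 < c) (h : X *ᵥ v = -(c • v)) : v = 0 := by
  by_contra hv
  have hdet : (((-c) • (1 : Mat N)) - X).det = 0 := by
    refine Matrix.exists_mulVec_eq_zero_iff.1 ⟨v, hv, ?_⟩
    rw [Matrix.sub_mulVec, h, Matrix.smul_mulVec, Matrix.one_mulVec]
    simp
  have hmem : ((-c : ℝ) : ℂ) ∈ spectrum ℂ (X.map (algebraMap ℝ ℂ)) := by
    rw [Matrix.mem_spectrum_iff_isRoot_charpoly, Matrix.charpoly_map, Polynomial.IsRoot.def,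
      Polynomial.eval_map]
    have : (Polynomial.eval₂ (algebraMap ℝ ℂ) (algebraMap ℝ ℂ (-c)) X.charpoly)
        = algebraMap ℝ ℂ (X.charpoly.eval (-c)) := Polynomial.eval₂_at_apply _ _
    rw [Matrix.eval_charpoly, Matrix.scalar_apply, ← Matrix.smul_one_eq_diagonal, hdet,
      map_zero] at this
    exact this
  have := (hX _ hmem).2
  simp at this
  linarith

/-! ### The Sylvester equation -/

lemma eq_zero_of_sylvester {X S Z : Mat N} (hX : PosEigenvalues X) (hS : HasSimplePosSpectrum S)
    (h : X * Z + Z * S = 0) : Z = 0 := by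
  obtain ⟨Q, R, μ, hRQ, hQ, -, hpos⟩ := hS
  have hQR : Q * R = 1 := mul_eq_one_comm.1 hRQ
  have hSR : S * R = R * Matrix.diagonal μ := by
    calc S * R = R * (Q * S) * R := by rw [← mul_assoc, hRQ, one_mul]
      _ = R * Matrix.diagonal μ := by rw [hQ, mul_assoc, mul_assoc, hQR, mul_one]
  have hW : X * (Z * R) = -(Z * R * Matrix.diagonal μ) := by
    rw [mul_assoc Z, ← hSR, ← mul_assoc, ← mul_assoc, ← neg_mul, eq_neg_of_add_eq_zero_left h]
  -- The columns of `Z * R` would be eigenvectors of `X` with eigenvalues `-μ j < 0`.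
  have h0 : Z * R = 0 := by
    ext i j
    have hcol : X *ᵥ (fun k => (Z * R) k j) = -(μ j • fun k => (Z * R) k j) := by
      ext k
      have := congrFun (congrFun hW k) j
      rw [Matrix.neg_apply, Matrix.mul_diagonal, Matrix.mul_apply] at this
      simp only [Matrix.mulVec, dotProduct, Pi.neg_apply, Pi.smul_apply, smul_eq_mul]
      rw [this]; ring
    exact congrFun (hX.eq_zero_of_mulVec_eq (hpos j) hcol) i
  calc Z = Z * R * Q := by rw [mul_assoc, hRQ, mul_one]
    _ = 0 := by rw [h0, zero_mul]

/-- The positive inverse square root is unique: if `X² = Y²`, then `Z = X - Y` solves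
`X Z + Z Y = 0`. -/
lemma IsInvSqrt.eq {A X Y : Mat N} (hX : IsInvSqrt A X) (hY : Y * Y * A = 1)
    (hYs : HasSimplePosSpectrum Y) : X = Y := by
  have h1 : X * X = Y * Y := by
    have hA : A * (Y * Y) = 1 := mul_eq_one_comm.1 hY
    calc X * X = X * X * (A * (Y * Y)) := by rw [hA, mul_one]
      _ = Y * Y := by rw [← mul_assoc, hX.1, one_mul]
  refine sub_eq_zero.1 (eq_zero_of_sylvester hX.2 hYs ?_)
  rw [mul_sub, sub_mul, h1]
  abel

/-- The Sylvester operator `Z ↦ S Z + Z S`. -/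
def sylvester (S : Mat N) : Mat N →ₗ[ℝ] Mat N := LinearMap.mulLeft ℝ S + LinearMap.mulRight ℝ S

lemma HasSimplePosSpectrum.sylvester_injective {S : Mat N} (hS : HasSimplePosSpectrum S) :
    Function.Injective (sylvester S) :=
  (injective_iff_map_eq_zero _).2 fun _ hZ => eq_zero_of_sylvester hS.posEigenvalues hS hZ

lemma HasSimplePosSpectrum.sylvester_bijective {S : Mat N} (hS : HasSimplePosSpectrum S) :
    Function.Bijective (sylvester S) :=
  ⟨hS.sylvester_injective, LinearMap.injective_iff_surjective.1 hS.sylvester_injective⟩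

/-! ### Hyperbolicity and the positive square root at a point -/

lemma HasSimplePosSpectrum.exists_invSqrt {A : Mat N} (hA : HasSimplePosSpectrum A) :
    ∃ X : Mat N, X * X * A = 1 ∧ HasSimplePosSpectrum X := by
  obtain ⟨Q, R, μ, hRQ, hQ, hinj, hpos⟩ := hA
  have hQR : Q * R = 1 := mul_eq_one_comm.1 hRQ
  set ν : Fin N → ℝ := fun j => (√(μ j))⁻¹ with hν
  have hQX : Q * (R * Matrix.diagonal ν * Q) = Matrix.diagonal ν * Q := by
    rw [← mul_assoc, ← mul_assoc, hQR, one_mul]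
  refine ⟨R * Matrix.diagonal ν * Q, ?_, Q, R, ν, hRQ, hQX, ?_, fun j => ?_⟩
  · have hD : Matrix.diagonal ν * (Matrix.diagonal ν * Matrix.diagonal μ) = 1 := by
      rw [Matrix.diagonal_mul_diagonal, Matrix.diagonal_mul_diagonal, ← Matrix.diagonal_one]
      congr 1
      ext j
      have h1 := Real.mul_self_sqrt (hpos j).le
      have h2 := (Real.sqrt_pos.2 (hpos j)).ne'
      simp only [hν]
      field_simp
      rw [sq, h1]
    calc R * Matrix.diagonal ν * Q * (R * Matrix.diagonal ν * Q) * A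
        = R * Matrix.diagonal ν * (Q * (R * Matrix.diagonal ν * Q)) * A := by simp only [mul_assoc]
      _ = R * Matrix.diagonal ν * (Matrix.diagonal ν * (Q * A)) := by
          rw [hQX]; simp only [mul_assoc]
      _ = R * (Matrix.diagonal ν * (Matrix.diagonal ν * Matrix.diagonal μ)) * Q := by
          rw [hQ]; simp only [mul_assoc]
      _ = 1 := by rw [hD, mul_one, hRQ]
  · intro i j hij
    have h := inv_injective hij
    exact hinj ((Real.sqrt_inj (hpos i).le (hpos j).le).1 h)
  · exact inv_pos.2 (Real.sqrt_pos.2 (hpos j))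

/-- In the conormal direction the characteristic equation reads `det (A - λ²) = 0`. Its roots come
in pairs `±λ`, so `2N` different roots yield at least `N` different positive ones. -/
lemma SecondOrderSystem.HyperbolicAt.hasSimplePosSpectrum {sys : SecondOrderSystem N} {O : Tan}
    (h : sys.HyperbolicAt O) : HasSimplePosSpectrum (sys.A O) := by
  set T : Set ℝ := {l : ℝ | sys.charDet O l 1 0 = 0} with hT
  have hcard : T.ncard = 2 * N := h 1 0 (by simp)
  have hTmem : ∀ l, l ∈ T ↔ (sys.A O - l ^ 2 • (1 : Mat N)).det = 0 := by
    intro l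
    simp [hT, SecondOrderSystem.charDet, sub_eq_add_neg, add_comm]
  set P : Set ℝ := T ∩ Ioi 0 with hP
  have hle : N ≤ P.ncard := by
    -- For `N = 0` there is nothing to show; otherwise `ncard ≠ 0` makes the set of roots finite.
    rcases Nat.eq_zero_or_pos N with h0 | h0
    · omega
    have hfin : T.Finite := Set.finite_of_ncard_pos (by omega)
    have hsub : T ⊆ P ∪ ((fun x => -x) '' P ∪ {0}) := by
      intro l hl
      rcases lt_trichotomy l 0 with h1 | h1 | h1
      · refine Or.inr (Or.inl ⟨-l, ⟨?_, by simpa using h1⟩, by simp⟩)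
        rw [hTmem] at hl ⊢
        simpa using hl
      · exact Or.inr (Or.inr h1)
      · exact Or.inl ⟨hl, h1⟩
    have hPf : P.Finite := hfin.subset inter_subset_left
    have h1 := Set.ncard_le_ncard hsub
      (hPf.union ((hPf.image _).union (Set.finite_singleton 0)))
    have h2 := Set.ncard_union_le P ((fun x => -x) '' P ∪ {0})
    have h3 := Set.ncard_union_le ((fun x => -x) '' P) {0}
    have h4 := Set.ncard_image_le (f := fun x : ℝ => -x) hPf
    rw [Set.ncard_singleton] at h3
    omega
  obtain ⟨F, hFP, hF⟩ : ∃ F : Finset ℝ, (F : Set ℝ) ⊆ P ∧ F.card = N := by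
    obtain ⟨t, ht, htN⟩ := Set.exists_subset_card_eq hle
    rcases Nat.eq_zero_or_pos N with h0 | h0
    · exact ⟨∅, by simp, by simp [h0]⟩
    · have htf : t.Finite := Set.finite_of_ncard_pos (by omega)
      exact ⟨htf.toFinset, by simpa using ht, by rw [← Set.ncard_eq_toFinset_card t htf, htN]⟩
  let e := F.equivFinOfCardEq hF
  have he : ∀ j, ((e.symm j : F) : ℝ) ∈ P := fun j => hFP (e.symm j).2
  refine hasSimplePosSpectrum_of_det_eq_zero (μ := fun j => ((e.symm j : F) : ℝ) ^ 2) ?_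
    (fun j => pow_pos (he j).2 2) fun j => (hTmem _).1 (he j).1
  intro i j hij
  have := (pow_left_inj₀ (he i).2.le (he j).2.le two_ne_zero).1 hij
  exact e.symm.injective (Subtype.ext this)

/-! ### Stability of the simple positive spectrum -/

/-- Simple positive eigenvalues persist under small perturbations: `x ↦ det (x - M)` changes its
sign between `μ j - r` and `μ j + r` for every `j`, with disjoint intervals. -/
lemma HasSimplePosSpectrum.eventually {E : Type*} [TopologicalSpace E] {M : E → Mat N} {x₀ : E}
    (h : HasSimplePosSpectrum (M x₀)) (hM : ContinuousAt M x₀) :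
    ∀ᶠ x in 𝓝 x₀, HasSimplePosSpectrum (M x) := by
  obtain ⟨Q, R, μ, hRQ, hQ, hinj, hpos⟩ := h
  obtain ⟨r, hr0, hrpos, hrsep⟩ : ∃ r : ℝ, 0 < r ∧ (∀ j, r < μ j) ∧
      ∀ i j, i ≠ j → 2 * r < |μ i - μ j| := by
    have h1 : ∀ᶠ r in 𝓝[>] (0 : ℝ), ∀ j, r < μ j :=
      eventually_all.2 fun j => nhdsWithin_le_nhds (eventually_lt_nhds (hpos j))
    have h2 : ∀ᶠ r in 𝓝[>] (0 : ℝ), ∀ i j, i ≠ j → 2 * r < |μ i - μ j| := by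
      refine eventually_all.2 fun i => eventually_all.2 fun j => ?_
      by_cases hij : i = j
      · simp [hij]
      have hd : 0 < |μ i - μ j| / 2 := half_pos (abs_pos.2 (sub_ne_zero.2 (hinj.ne hij)))
      filter_upwards [nhdsWithin_le_nhds (eventually_lt_nhds hd)] with r hr _
      linarith
    obtain ⟨r, h⟩ := (h1.and (h2.and self_mem_nhdsWithin)).exists
    exact ⟨r, h.2.2, h.1, h.2.1⟩
  have hcont : ∀ c : ℝ, ContinuousAt (fun x => (c • (1 : Mat N) - M x).det) x₀ := fun c =>
    (Continuous.matrix_det continuous_id).continuousAt.comp (continuousAt_const.sub hM)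
  have hsign : ∀ j, ∀ᶠ x in 𝓝 x₀,
      (((μ j - r) • (1 : Mat N) - M x).det * ((μ j + r) • (1 : Mat N) - M x).det) < 0 := by
    intro j
    refine ((hcont (μ j - r)).mul (hcont (μ j + r))).eventually (Iio_mem_nhds ?_)
    rw [Pi.mul_apply, det_smul_one_sub_of_diagonalized hRQ hQ,
      det_smul_one_sub_of_diagonalized hRQ hQ,
      ← Finset.prod_mul_distrib, ← Finset.mul_prod_erase _ _ (Finset.mem_univ j)]
    refine mul_neg_of_neg_of_pos (by nlinarith) (Finset.prod_pos fun k hk => ?_)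
    -- The factor of `j` is `-r²`; the one of `k ≠ j` is `(μ j - μ k)² - r² > 0`.
    have h1 := hrsep j k (Finset.ne_of_mem_erase hk).symm
    have h2 : r ^ 2 < |μ j - μ k| ^ 2 := by
      refine pow_lt_pow_left₀ (by linarith) hr0.le two_ne_zero
    rw [sq_abs] at h2
    nlinarith
  filter_upwards [eventually_all.2 hsign] with x hx
  have hroot : ∀ j, ∃ l ∈ Icc (μ j - r) (μ j + r), (l • (1 : Mat N) - M x).det = 0 := by
    intro j
    have hc : ContinuousOn (fun l : ℝ => (l • (1 : Mat N) - M x).det) (Icc (μ j - r) (μ j + r)) :=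
      (Continuous.matrix_det (by fun_prop)).continuousOn
    have hle : μ j - r ≤ μ j + r := by linarith
    rcases mul_neg_iff.1 (hx j) with ⟨h1, h2⟩ | ⟨h1, h2⟩
    · exact intermediate_value_Icc' hle hc ⟨h2.le, h1.le⟩
    · exact intermediate_value_Icc hle hc ⟨h1.le, h2.le⟩
  choose l hl hl0 using hroot
  refine hasSimplePosSpectrum_of_det_eq_zero (μ := l) ?_ ?_ fun j => ?_
  · intro i j hij
    by_contra hne
    have h1 := hrsep i j hne
    have h2 := hl i
    have h3 := hl j
    rw [hij] at h2
    have : |μ i - μ j| ≤ 2 * r := abs_le.2 ⟨by linarith [h2.2, h3.1], by linarith [h2.1, h3.2]⟩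
    linarith
  · intro j
    linarith [(hl j).1, hrpos j]
  · rw [← neg_sub, Matrix.det_neg, hl0 j, mul_zero]

/-! ### Smooth matrix functions and the smooth square root -/

section NormedAlgebra

variable {𝔸 : Type*} [NormedRing 𝔸] [NormedAlgebra ℝ 𝔸]

/-- The Sylvester operator `Z ↦ a Z + Z a` of a normed algebra, as a continuous linear map. For
matrices it is used with the operator norm. -/
noncomputable def sylvesterL (a : 𝔸) : 𝔸 →L[ℝ] 𝔸 :=
  ContinuousLinearMap.mul ℝ 𝔸 a + (ContinuousLinearMap.mul ℝ 𝔸).flip a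

lemma sylvesterL_apply (a z : 𝔸) : sylvesterL a z = a * z + z * a := rfl

lemma exists_equiv_sylvesterL [FiniteDimensional ℝ 𝔸] {a : 𝔸}
    (ha : Function.Injective (sylvesterL a)) :
    ∃ e : 𝔸 ≃L[ℝ] 𝔸, (e : 𝔸 →L[ℝ] 𝔸) = sylvesterL a :=
  ⟨(LinearEquiv.ofInjectiveEndo (sylvesterL a : 𝔸 →ₗ[ℝ] 𝔸) ha).toContinuousLinearEquiv, rfl⟩

/-- The inverse function theorem for `x ↦ x²`, whose derivative is the Sylvester operator. -/
lemma exists_contDiffAt_sqrt [FiniteDimensional ℝ 𝔸] {a : 𝔸}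
    (ha : Function.Injective (sylvesterL a)) :
    ∃ G : 𝔸 → 𝔸, G (a * a) = a ∧ ContDiffAt ℝ ∞ G (a * a) ∧ ∀ᶠ y in 𝓝 (a * a), G y * G y = y := by
  have : CompleteSpace 𝔸 := FiniteDimensional.complete ℝ 𝔸
  obtain ⟨e, he⟩ := exists_equiv_sylvesterL ha
  have hsq : ContDiffAt ℝ ∞ (fun y : 𝔸 => y * y) a := contDiffAt_id.mul contDiffAt_id
  have hsq' : HasFDerivAt (fun y : 𝔸 => y * y) (e : 𝔸 →L[ℝ] 𝔸) a := by
    rw [he]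
    refine ((hasFDerivAt_id a).mul' (hasFDerivAt_id a)).congr_fderiv ?_
    ext1 z
    simp [sylvesterL_apply]
  have hn : (∞ : WithTop ℕ∞) ≠ 0 := by simp
  exact ⟨hsq.localInverse hsq' hn, hsq.localInverse_apply_image hsq' hn,
    hsq.to_localInverse hsq' hn, (hsq.hasStrictFDerivAt' hsq' hn).eventually_right_inverse⟩

/-- Smooth solvability of `a z + z a = b`, since inversion of continuous linear maps is smooth. -/
lemma exists_contDiffAt_sylvesterL [FiniteDimensional ℝ 𝔸] {E : Type*} [NormedAddCommGroup E]
    [NormedSpace ℝ E] {n : WithTop ℕ∞} {a b : E → 𝔸} {x₀ : E} (ha : ContDiffAt ℝ n a x₀)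
    (hb : ContDiffAt ℝ n b x₀) (hinj : Function.Injective (sylvesterL (a x₀))) :
    ∃ z : E → 𝔸, ContDiffAt ℝ n z x₀ ∧
      ∀ x, Function.Injective (sylvesterL (a x)) → a x * z x + z x * a x = b x := by
  have : CompleteSpace 𝔸 := FiniteDimensional.complete ℝ 𝔸
  have hL : ContDiffAt ℝ n (fun x => sylvesterL (a x)) x₀ :=
    ((ContinuousLinearMap.mul ℝ 𝔸).contDiff.contDiffAt.comp x₀ ha).add
      ((ContinuousLinearMap.mul ℝ 𝔸).flip.contDiff.contDiffAt.comp x₀ ha)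
  refine ⟨fun x => ContinuousLinearMap.inverse (sylvesterL (a x)) (b x), ?_, fun x hx => ?_⟩
  · refine ContDiffAt.clm_apply ?_ hb
    obtain ⟨e, he⟩ := exists_equiv_sylvesterL hinj
    refine ContDiffAt.comp x₀ (g := ContinuousLinearMap.inverse) ?_ hL
    rw [← he]
    exact contDiffAt_map_inverse e
  · obtain ⟨e, he⟩ := exists_equiv_sylvesterL hx
    change sylvesterL (a x) ((sylvesterL (a x)).inverse (b x)) = b x
    rw [← he, ContinuousLinearMap.inverse_equiv]
    exact e.apply_symm_apply _

end NormedAlgebra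

section MatrixNorm

open scoped Matrix.Norms.Operator

variable {E : Type*} [NormedAddCommGroup E] [NormedSpace ℝ E]

/-- Smoothness of the entries is smoothness with respect to any norm on the space of matrices. -/
lemma contDiffAt_matrix_iff {n : WithTop ℕ∞} {M : E → Mat N} {x : E} :
    ContDiffAt ℝ n M x ↔ ∀ j k, ContDiffAt ℝ n (fun y => M y j k) x := by
  constructor
  · intro h j k
    exact (LinearMap.toContinuousLinearMap
      (Matrix.entryLinearMap ℝ ℝ j k : Mat N →ₗ[ℝ] ℝ)).contDiff.contDiffAt.comp x h
  · intro h
    have : M = fun y => ∑ j, ∑ k, M y j k • Matrix.single j k (1 : ℝ) := by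
      ext1 y
      conv_lhs => rw [Matrix.matrix_eq_sum_single (M y)]
      simp [Matrix.smul_single]
    rw [this]
    exact ContDiffAt.sum fun j _ => ContDiffAt.sum fun k _ => (h j k).smul contDiffAt_const

/-- The inverse square root of a smooth matrix function with simple positive spectrum is smooth. -/
lemma exists_smooth_invSqrt {A : E → Mat N} {x₀ : E} (hA : SmoothMatAt A x₀)
    (hs : HasSimplePosSpectrum (A x₀)) :
    ∃ S : E → Mat N, SmoothMatAt S x₀ ∧
      ∀ᶠ x in 𝓝 x₀, S x * S x * A x = 1 ∧ HasSimplePosSpectrum (S x) := by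
  obtain ⟨X, hX, hXs⟩ := hs.exists_invSqrt
  have hu : IsUnit (A x₀) := IsUnit.of_mul_eq_one_right _ hX
  have hXX : X * X = Ring.inverse (A x₀) := by
    rw [← one_mul (Ring.inverse (A x₀)), Ring.eq_mul_inverse_iff_mul_eq _ _ _ hu, hX]
  have hA' : ContDiffAt ℝ ∞ A x₀ := contDiffAt_matrix_iff.2 hA
  have hinv : ContDiffAt ℝ ∞ (fun x => Ring.inverse (A x)) x₀ := by
    have := contDiffAt_ringInverse ℝ (n := ∞) hu.unit
    rw [IsUnit.unit_spec] at this
    exact this.comp x₀ hA'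
  obtain ⟨G, hGX, hG, hGG⟩ := exists_contDiffAt_sqrt (a := X) hXs.sylvester_injective
  rw [hXX] at hGX hG hGG
  have hS : ContDiffAt ℝ ∞ (fun x => G (Ring.inverse (A x))) x₀ :=
    ContDiffAt.comp x₀ (g := G) hG hinv
  have h1 : ∀ᶠ x in 𝓝 x₀, IsUnit (A x) := hA'.continuousAt.eventually (Units.isOpen.mem_nhds hu)
  have h3 : ∀ᶠ x in 𝓝 x₀, HasSimplePosSpectrum (G (Ring.inverse (A x))) :=
    HasSimplePosSpectrum.eventually (M := fun x => G (Ring.inverse (A x)))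
      (by simpa only [hGX] using hXs) hS.continuousAt
  refine ⟨fun x => G (Ring.inverse (A x)), contDiffAt_matrix_iff.1 hS, ?_⟩
  filter_upwards [h1, hinv.continuousAt.eventually hGG, h3] with x hx1 hx2 hx3
  exact ⟨by rw [hx2, Ring.inverse_mul_cancel _ hx1], hx3⟩

/-- The solution of a Sylvester equation depends smoothly on its coefficients. -/
lemma exists_contDiffAt_sylvester {n : WithTop ℕ∞} {S R : E → Mat N} {x₀ : E}
    (hS : ∀ j k, ContDiffAt ℝ n (fun x => S x j k) x₀)
    (hR : ∀ j k, ContDiffAt ℝ n (fun x => R x j k) x₀) (hs : HasSimplePosSpectrum (S x₀)) :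
    ∃ Z : E → Mat N, (∀ j k, ContDiffAt ℝ n (fun x => Z x j k) x₀) ∧
      ∀ x, HasSimplePosSpectrum (S x) → S x * Z x + Z x * S x = R x := by
  obtain ⟨Z, hZ, hZ'⟩ := exists_contDiffAt_sylvesterL (contDiffAt_matrix_iff.2 hS)
    (contDiffAt_matrix_iff.2 hR) hs.sylvester_injective
  exact ⟨Z, contDiffAt_matrix_iff.1 hZ, fun x hx => hZ' x hx.sylvester_injective⟩

end MatrixNorm

/-! ### Tangential operators and the Sylvester equation for them -/

lemma hasFDerivAt_tan_coord (i : Fin 2) (O : Tan) (e : Vec N) :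
    HasFDerivAt (fun τ : Tan => (τ i - O i) • e)
      ((ContinuousLinearMap.proj (R := ℝ) (φ := fun _ : Fin 2 => ℝ) i).smulRight e) O :=
  (((ContinuousLinearMap.proj (R := ℝ) (φ := fun _ : Fin 2 => ℝ) i).hasFDerivAt).sub_const
    (O i)).smul_const e

/-- The coefficients of a tangential operator are determined by its values on constants and on
linear functions. -/
lemma TanOp.app_injective {P P' : TanOp N} {O : Tan}
    (h : ∀ φ : Tan → Vec N, ContDiff ℝ ∞ φ → P.app φ O = P'.app φ O) : P = P' := by
  apply TanOp.ext
  · refine Matrix.mulVec_injective (funext fun e => ?_)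
    have := h (fun _ => e) contDiff_const
    simpa [TanOp.app] using this
  · funext i
    refine Matrix.mulVec_injective (funext fun e => ?_)
    have := h (fun τ => (τ i - O i) • e) (by fun_prop)
    simp only [TanOp.app, (hasFDerivAt_tan_coord i O e).fderiv] at this
    simpa [tanDir, Pi.single_apply, apply_ite (Matrix.mulVec _)] using this

lemma contDiffAt_mulVec {E : Type*} [NormedAddCommGroup E] [NormedSpace ℝ E] {n : WithTop ℕ∞}
    {M : E → Mat N} {f : E → Vec N} {x : E} (hM : ∀ j k, ContDiffAt ℝ n (fun y => M y j k) x)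
    (hf : ContDiffAt ℝ n f x) : ContDiffAt ℝ n (fun y => M y *ᵥ f y) x := by
  refine contDiffAt_pi.2 fun j => ?_
  simp only [Matrix.mulVec, dotProduct]
  exact ContDiffAt.sum fun k _ => (hM j k).mul (contDiffAt_pi.1 hf k)

lemma fderiv_mulVec {M : Tan → Mat N} {φ : Tan → Vec N} {τ : Tan}
    (hM : ∀ j k, DifferentiableAt ℝ (fun y => M y j k) τ) (hφ : DifferentiableAt ℝ φ τ)
    (i : Fin 2) :
    fderiv ℝ (fun y => M y *ᵥ φ y) τ (tanDir i) =
      dMat i M τ *ᵥ φ τ + M τ *ᵥ fderiv ℝ φ τ (tanDir i) := by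
  have hφ' := differentiableAt_pi.1 hφ
  ext j
  have h1 : HasFDerivAt (fun y => (M y *ᵥ φ y) j)
      (∑ k, (M τ j k • fderiv ℝ (fun y => φ y k) τ + φ τ k • fderiv ℝ (fun y => M y j k) τ)) τ := by
    simp only [Matrix.mulVec, dotProduct]
    exact HasFDerivAt.fun_sum fun k _ => (hM j k).hasFDerivAt.mul (hφ' k).hasFDerivAt
  have h2 : DifferentiableAt ℝ (fun y => M y *ᵥ φ y) τ := by
    refine differentiableAt_pi.2 fun j => ?_
    simp only [Matrix.mulVec, dotProduct]
    exact DifferentiableAt.fun_sum fun k _ => (hM j k).mul (hφ' k)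
  have h3 : ∀ k, fderiv ℝ (fun y => φ y k) τ (tanDir i) = fderiv ℝ φ τ (tanDir i) k := fun k => by
    rw [fderiv_apply hφ]; rfl
  have h4 : fderiv ℝ (fun y => M y *ᵥ φ y) τ (tanDir i) j =
      fderiv ℝ (fun y => (M y *ᵥ φ y) j) τ (tanDir i) := by
    rw [fderiv_apply h2]; rfl
  rw [h4, h1.fderiv]
  simp [Matrix.mulVec, dotProduct, dMat, Finset.sum_add_distrib, h3, add_comm, mul_comm]

/-- The Sylvester equation at `τ`, written out for the coefficients of `P = p + (q∇_τ)`: one matrix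
equation for each `q i`, and one for `p` that contains the `q i`. -/
def SylvesterCoeffs (sys : SecondOrderSystem N) (S : Tan → Mat N) (τ : Tan) (P : TanOp N) : Prop :=
  (∀ i, S τ * P.q i + P.q i * S τ = -((sys.A τ)⁻¹ * (sys.B i τ * S τ))) ∧
  S τ * P.p + P.p * S τ = -((sys.A τ)⁻¹ * ((∑ i, sys.B i τ * dMat i S τ) + sys.C (0, τ) * S τ)) -
    ∑ i, P.q i * dMat i S τ

lemma solvesSylvester_iff {sys : SecondOrderSystem N} {S : Tan → Mat N} {O : Tan} {P : TanOp N}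
    (hS : SmoothMatAt S O) : SolvesSylvester sys S O P ↔ SylvesterCoeffs sys S O P := by
  have hS' : ∀ j k, DifferentiableAt ℝ (fun y => S y j k) O := fun j k =>
    (hS j k).differentiableAt (by simp)
  -- Both sides of the equation are tangential operators `L` and `R` of order at most one, so they
  -- agree on all smooth functions exactly when their coefficients agree.
  set L : TanOp N := ⟨S O * P.p + P.p * S O + ∑ i, P.q i * dMat i S O,
    fun i => S O * P.q i + P.q i * S O⟩ with hL
  set R : TanOp N := ⟨-((sys.A O)⁻¹ * ((∑ i, sys.B i O * dMat i S O) + sys.C (0, O) * S O)),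
    fun i => -((sys.A O)⁻¹ * (sys.B i O * S O))⟩ with hR
  have hLa : ∀ φ : Tan → Vec N, ContDiffAt ℝ ∞ φ O →
      S O *ᵥ P.app φ O + P.app (fun τ => S τ *ᵥ φ τ) O = L.app φ O := by
    intro φ hφ
    have hφ' : DifferentiableAt ℝ φ O := hφ.differentiableAt (by simp)
    simp only [TanOp.app, hL, fderiv_mulVec hS' hφ', Fin.sum_univ_two, Matrix.mulVec_add,
      Matrix.add_mulVec, Matrix.mulVec_mulVec]
    abel
  have hRa : ∀ φ : Tan → Vec N,
      -((sys.A O)⁻¹ *ᵥ ((∑ i, (sys.B i O * dMat i S O) *ᵥ φ O) +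
        (∑ i, (sys.B i O * S O) *ᵥ fderiv ℝ φ O (tanDir i)) + (sys.C (0, O) * S O) *ᵥ φ O)) =
      R.app φ O := by
    intro φ
    simp only [TanOp.app, hR, Fin.sum_univ_two, Matrix.mulVec_add, Matrix.mul_add,
      Matrix.add_mulVec, Matrix.mulVec_mulVec, Matrix.neg_mulVec]
    abel
  have h1 : SolvesSylvester sys S O P ↔ L = R := by
    constructor
    · intro h
      refine TanOp.app_injective (O := O) fun φ hφ => ?_
      rw [← hLa φ hφ.contDiffAt, ← hRa φ]
      exact h φ hφ.contDiffAt
    · intro h φ hφ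
      rw [hLa φ hφ, hRa φ, h]
  rw [h1, TanOp.ext_iff, and_comm, SylvesterCoeffs]
  refine and_congr funext_iff ?_
  rw [eq_sub_iff_add_eq]

lemma existsUnique_sylvesterCoeffs (sys : SecondOrderSystem N) {S : Tan → Mat N} {τ : Tan}
    (hS : HasSimplePosSpectrum (S τ)) : ∃! P : TanOp N, SylvesterCoeffs sys S τ P := by
  obtain ⟨hinj, hsurj⟩ := hS.sylvester_bijective
  choose q hq using fun i => hsurj (-((sys.A τ)⁻¹ * (sys.B i τ * S τ)))
  obtain ⟨p, hp⟩ := hsurj (-((sys.A τ)⁻¹ * ((∑ i, sys.B i τ * dMat i S τ) +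
    sys.C (0, τ) * S τ)) - ∑ i, q i * dMat i S τ)
  refine ⟨⟨p, q⟩, ⟨hq, hp⟩, fun P hP => ?_⟩
  have hPq : P.q = q := funext fun i => hinj ((hP.1 i).trans (hq i).symm)
  refine TanOp.ext (hinj (hP.2.trans ?_)) hPq
  rw [hPq]; exact hp.symm

lemma contDiffAt_dMat {S : Tan → Mat N} {O : Tan} (hS : SmoothMatAt S O) (i : Fin 2) :
    SmoothMatAt (dMat i S) O := fun j k =>
  ((hS j k).fderiv_right (m := ∞) (by simp)).clm_apply contDiffAt_const

/-! ### Decaying solutions of linear differential equations on the half line -/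

/-- A source term that grows exponentially forces the solution to grow. -/
lemma eq_zero_of_hasDerivAt_exp_of_tendsto {f g : ℝ → ℝ} {l c : ℝ} (hl : 0 < l)
    (hf : ∀ x, 0 ≤ x → HasDerivAt f (c * Real.exp (l * x) - l * f x + g x) x)
    (hf0 : Tendsto f atTop (𝓝 0)) (hg0 : Tendsto g atTop (𝓝 0)) : c = 0 := by
  wlog hc : 0 < c generalizing f g c with H
  · rcases (not_lt.1 hc).lt_or_eq with h | h
    · have := H (f := fun x => -f x) (g := fun x => -g x) (c := -c)
        (fun x hx => (hf x hx).neg.congr_deriv (by ring)) (by simpa using hf0.neg)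
        (by simpa using hg0.neg) (by linarith)
      linarith
    · exact h
  exfalso
  have hexp : Tendsto (fun x => c * Real.exp (l * x)) atTop atTop :=
    (Real.tendsto_exp_atTop.comp (tendsto_id.const_mul_atTop hl)).const_mul_atTop hc
  have hder : Tendsto (fun x => c * Real.exp (l * x) + (-(l * f x) + g x)) atTop atTop :=
    hexp.atTop_add (((hf0.const_mul l).neg).add hg0)
  -- From some point on `f' ≥ 1`, although `f (x + 1) - f x → 0`.
  obtain ⟨a, ha⟩ := eventually_atTop.1 (hder.eventually_ge_atTop 1)
  have hdiff : Tendsto (fun x => f (x + 1) - f x) atTop (𝓝 0) := by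
    simpa using (hf0.comp (tendsto_atTop_add_const_right _ 1 tendsto_id)).sub hf0
  obtain ⟨x, hx1, hx2⟩ := ((hdiff.eventually (eventually_lt_nhds one_pos)).and
    (eventually_ge_atTop (max a 0))).exists
  have hx0 : 0 ≤ x := (le_max_right _ _).trans hx2
  have hxa : a ≤ x := (le_max_left _ _).trans hx2
  obtain ⟨y, hy, hy'⟩ := exists_hasDerivAt_eq_slope f
    (fun x => c * Real.exp (l * x) - l * f x + g x) (by linarith : x < x + 1)
    (fun y hy => (hf y (hx0.trans hy.1)).continuousAt.continuousWithinAt)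
    (fun y hy => hf y (hx0.trans hy.1.le))
  have := ha y (hxa.trans hy.1.le)
  rw [add_sub_cancel_left, div_one] at hy'
  linarith

lemma eq_mul_exp_of_hasDerivAt {z : ℝ → ℝ} {l : ℝ} (hz : ∀ x, 0 ≤ x → HasDerivAt z (l * z x) x)
    {x : ℝ} (hx : 0 ≤ x) : z x = z 0 * Real.exp (l * x) := by
  have hd : ∀ y, 0 ≤ y → HasDerivAt (fun y => z y * Real.exp (-(l * y))) 0 y := fun y hy => by
    have h1 : HasDerivAt (fun y => Real.exp (-(l * y))) (Real.exp (-(l * y)) * (-(l * 1))) y :=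
      ((hasDerivAt_id y).const_mul l).neg.exp
    exact ((hz y hy).mul h1).congr_deriv (by ring)
  have := constant_of_has_deriv_right_zero (a := 0) (b := x)
    (fun y hy => (hd y hy.1).continuousAt.continuousWithinAt)
    (fun y hy => (hd y hy.1).hasDerivWithinAt) x ⟨hx, le_rfl⟩
  simp only [mul_zero, neg_zero, Real.exp_zero, mul_one] at this
  rw [← this, mul_assoc, ← Real.exp_add]
  simp

/-- For `r' = -l r + h` with `h → 0`, the function `(r - e / 2) e^{lx}` is eventually decreasing. -/
lemma eventually_lt_of_hasDerivAt {r h : ℝ → ℝ} {l : ℝ} (hl : 0 < l)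
    (hr : ∀ x, 0 ≤ x → HasDerivAt r (-(l * r x) + h x) x) (hh : Tendsto h atTop (𝓝 0)) {e : ℝ}
    (he : 0 < e) : ∀ᶠ x in atTop, r x < e := by
  obtain ⟨a, ha⟩ := eventually_atTop.1
    (hh.eventually (eventually_le_nhds (by positivity : 0 < l * (e / 2))))
  set b := max a 0 with hb
  have hd : ∀ y, b ≤ y → HasDerivAt (fun y => (r y - e / 2) * Real.exp (l * y))
      ((h y - l * (e / 2)) * Real.exp (l * y)) y := fun y hy => by
    have h1 : HasDerivAt (fun y => Real.exp (l * y)) (Real.exp (l * y) * (l * 1)) y :=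
      ((hasDerivAt_id y).const_mul l).exp
    exact (((hr y ((le_max_right _ _).trans hy)).sub_const (e / 2)).mul h1).congr_deriv (by ring)
  have hanti : AntitoneOn (fun y => (r y - e / 2) * Real.exp (l * y)) (Ici b) := by
    refine antitoneOn_of_deriv_nonpos (convex_Ici b)
      (fun y hy => (hd y hy).continuousAt.continuousWithinAt) (fun y hy => ?_) (fun y hy => ?_)
    · exact (hd y (interior_subset hy)).differentiableAt.differentiableWithinAt
    · rw [(hd y (interior_subset hy)).deriv]
      have := ha y ((le_max_left _ _).trans (interior_subset hy))
      exact mul_nonpos_of_nonpos_of_nonneg (by linarith) (Real.exp_pos _).le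
  have hlim : Tendsto (fun y => (r b - e / 2) * Real.exp (l * b) * Real.exp (-(l * y))) atTop
      (𝓝 0) := by
    have : Tendsto (fun y => Real.exp (-(l * y))) atTop (𝓝 0) :=
      Real.tendsto_exp_neg_atTop_nhds_zero.comp (tendsto_id.const_mul_atTop hl)
    simpa using this.const_mul ((r b - e / 2) * Real.exp (l * b))
  filter_upwards [hlim.eventually (eventually_lt_nhds (half_pos he)), eventually_ge_atTop b]
    with y hy1 hy2
  have h1 := hanti self_mem_Ici hy2 hy2
  have h2 : (r y - e / 2) * Real.exp (l * y) * Real.exp (-(l * y)) ≤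
      (r b - e / 2) * Real.exp (l * b) * Real.exp (-(l * y)) :=
    mul_le_mul_of_nonneg_right h1 (Real.exp_pos _).le
  rw [mul_assoc, ← Real.exp_add, add_neg_cancel, Real.exp_zero, mul_one] at h2
  linarith

lemma tendsto_zero_of_hasDerivAt {r h : ℝ → ℝ} {l : ℝ} (hl : 0 < l)
    (hr : ∀ x, 0 ≤ x → HasDerivAt r (-(l * r x) + h x) x) (hh : Tendsto h atTop (𝓝 0)) :
    Tendsto r atTop (𝓝 0) := by
  refine tendsto_order.2 ⟨fun e he => ?_, fun e he => eventually_lt_of_hasDerivAt hl hr hh he⟩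
  have := eventually_lt_of_hasDerivAt (r := fun x => -r x) (h := fun x => -h x) (e := -e) hl
    (fun x hx => (hr x hx).neg.congr_deriv (by ring)) (by simpa using hh.neg) (by linarith)
  filter_upwards [this] with x hx
  linarith

lemma hasDerivAt_mulVec (M : Mat N) {w : ℝ → Vec N} {w' : Vec N} {x : ℝ}
    (hw : HasDerivAt w w' x) : HasDerivAt (fun y => M *ᵥ w y) (M *ᵥ w') x :=
  (LinearMap.toContinuousLinearMap (Matrix.mulVecLin M)).hasFDerivAt.comp_hasDerivAt x hw

lemma tendsto_mulVec {ι : Type*} {F : Filter ι} (M : Mat N) {w : ι → Vec N} {a : Vec N}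
    (hw : Tendsto w F (𝓝 a)) : Tendsto (fun y => M *ᵥ w y) F (𝓝 (M *ᵥ a)) :=
  ((LinearMap.toContinuousLinearMap (Matrix.mulVecLin M)).continuous.tendsto a).comp hw

lemma tendsto_mulVec_zero {ι : Type*} {F : Filter ι} (M : Mat N) {w : ι → Vec N}
    (hw : Tendsto w F (𝓝 0)) : Tendsto (fun y => M *ᵥ w y) F (𝓝 0) := by
  simpa using tendsto_mulVec M hw

lemma mulVec_diagonalized {Q S : Mat N} {μ : Fin N → ℝ} (hQ : Q * S = Matrix.diagonal μ * Q)
    (x : Vec N) (j : Fin N) : (Q *ᵥ (S *ᵥ x)) j = μ j * (Q *ᵥ x) j := by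
  rw [Matrix.mulVec_mulVec, hQ, ← Matrix.mulVec_mulVec, Matrix.mulVec_diagonal]

namespace HasSimplePosSpectrum

variable {S : Mat N}

/-- The residual `z = w' + S w - h` of the outgoing equation grows like `e^{ηS}` unless it vanishes;
decay of `w` and `h` excludes the growth. -/
lemma residual_eq_zero (hS : HasSimplePosSpectrum S) {w w' h : ℝ → Vec N}
    (hw : ∀ x, 0 ≤ x → HasDerivAt w (w' x) x)
    (hz : ∀ x, 0 ≤ x → HasDerivAt (fun y => w' y + S *ᵥ w y - h y)
      (S *ᵥ (w' x + S *ᵥ w x - h x)) x)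
    (hw0 : Tendsto w atTop (𝓝 0)) (hh0 : Tendsto h atTop (𝓝 0)) {x : ℝ} (hx : 0 ≤ x) :
    w' x = -(S *ᵥ w x) + h x := by
  obtain ⟨Q, R, μ, hRQ, hQ, -, hpos⟩ := hS
  have hzero : Q *ᵥ (w' x + S *ᵥ w x - h x) = 0 := by
    ext j
    have h1 : ∀ y, 0 ≤ y → HasDerivAt (fun y => (Q *ᵥ (w' y + S *ᵥ w y - h y)) j)
        (μ j * (Q *ᵥ (w' y + S *ᵥ w y - h y)) j) y := fun y hy => by
      have := hasDerivAt_pi.1 (hasDerivAt_mulVec Q (hz y hy)) j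
      rwa [mulVec_diagonalized hQ] at this
    have h2 : ∀ y, 0 ≤ y → (Q *ᵥ (w' y + S *ᵥ w y - h y)) j =
        (Q *ᵥ (w' 0 + S *ᵥ w 0 - h 0)) j * Real.exp (μ j * y) :=
      fun y hy => eq_mul_exp_of_hasDerivAt h1 hy
    have h3 := eq_zero_of_hasDerivAt_exp_of_tendsto (hpos j) (f := fun y => (Q *ᵥ w y) j)
      (g := fun y => (Q *ᵥ h y) j) (c := (Q *ᵥ (w' 0 + S *ᵥ w 0 - h 0)) j) (fun y hy => ?_)
      ((tendsto_pi_nhds.1 (tendsto_mulVec_zero Q hw0)) j)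
      ((tendsto_pi_nhds.1 (tendsto_mulVec_zero Q hh0)) j)
    · rw [h2 x hx, h3, zero_mul]; rfl
    · refine (hasDerivAt_pi.1 (hasDerivAt_mulVec Q (hw y hy)) j).congr_deriv ?_
      rw [← h2 y hy, Matrix.mulVec_sub, Matrix.mulVec_add, Pi.sub_apply, Pi.add_apply,
        mulVec_diagonalized hQ]
      ring
  have h0 : w' x + S *ᵥ w x - h x = 0 := by
    rw [← Matrix.one_mulVec (w' x + S *ᵥ w x - h x), ← hRQ, ← Matrix.mulVec_mulVec, hzero,
      Matrix.mulVec_zero]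
  rw [← sub_eq_zero, ← h0]
  abel

lemma tendsto_zero (hS : HasSimplePosSpectrum S) {r h : ℝ → Vec N}
    (hr : ∀ x, 0 ≤ x → HasDerivAt r (-(S *ᵥ r x) + h x) x) (hh : Tendsto h atTop (𝓝 0)) :
    Tendsto r atTop (𝓝 0) := by
  obtain ⟨Q, R, μ, hRQ, hQ, -, hpos⟩ := hS
  have hQr : Tendsto (fun x => Q *ᵥ r x) atTop (𝓝 0) := by
    refine tendsto_pi_nhds.2 fun j => ?_
    refine tendsto_zero_of_hasDerivAt (hpos j) (h := fun y => (Q *ᵥ h y) j) (fun x hx => ?_)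
      ((tendsto_pi_nhds.1 (tendsto_mulVec_zero Q hh)) j)
    refine (hasDerivAt_pi.1 (hasDerivAt_mulVec Q (hr x hx)) j).congr_deriv ?_
    rw [Matrix.mulVec_add, Matrix.mulVec_neg, Pi.add_apply, Pi.neg_apply, mulVec_diagonalized hQ]
  simpa [Matrix.mulVec_mulVec, hRQ] using tendsto_mulVec_zero R hQr

lemma eq_zero_of_hasDerivAt (hS : HasSimplePosSpectrum S) {r : ℝ → Vec N}
    (hr : ∀ x, 0 ≤ x → HasDerivAt r (-(S *ᵥ r x)) x) (hr0 : r 0 = 0) {x : ℝ} (hx : 0 ≤ x) :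
    r x = 0 := by
  obtain ⟨Q, R, μ, hRQ, hQ, -, hpos⟩ := hS
  have hQr : Q *ᵥ r x = 0 := by
    ext j
    have := eq_mul_exp_of_hasDerivAt (z := fun y => (Q *ᵥ r y) j) (l := -μ j) (fun y hy => ?_) hx
    · rw [this, hr0]; simp
    · refine (hasDerivAt_pi.1 (hasDerivAt_mulVec Q (hr y hy)) j).congr_deriv ?_
      rw [Matrix.mulVec_neg, Pi.neg_apply, mulVec_diagonalized hQ, neg_mul]
  rw [← Matrix.one_mulVec (r x), ← hRQ, ← Matrix.mulVec_mulVec, hQr, Matrix.mulVec_zero]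

end HasSimplePosSpectrum

section Profiles

/-! ### Partial derivatives and the stretched normal variable -/

lemma pd_const_smul (c : ℝ) (e : Loc) (f : Loc → Vec N) :
    pd e (fun x => c • f x) = fun x => c • pd e f x := by
  funext x
  have : fderiv ℝ (fun x => c • f x) x = c • fderiv ℝ f x :=
    congrFun (fderiv_const_smul_field (𝕜 := ℝ) (f := f) c) x
  simp [pd, this]

lemma pd_smul_dir (c : ℝ) (e : Loc) (f : Loc → Vec N) :
    pd (c • e) f = fun x => c • pd e f x := by
  funext x
  simp [pd]

lemma pd_eventuallyEq {e : Loc} {f g : Loc → Vec N} {x : Loc} (h : f =ᶠ[𝓝 x] g) :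
    pd e f x = pd e g x := by
  simp only [pd, h.fderiv_eq]

/-- The linear change of variables `(η, τ) ↦ (ε η, τ)`. -/
noncomputable def stretch (ε : ℝ) (hε : ε ≠ 0) : Loc ≃L[ℝ] Loc :=
  (ContinuousLinearEquiv.unitsEquivAut ℝ (Units.mk0 ε hε)).prodCongr
    (ContinuousLinearEquiv.refl ℝ Tan)

lemma stretch_apply (ε : ℝ) (hε : ε ≠ 0) (y : Loc) : stretch ε hε y = (ε * y.1, y.2) := by
  simp [stretch, mul_comm]

lemma rescale_eq_comp_stretch (U : ℝ → Loc → Vec N) {ε : ℝ} (hε : ε ≠ 0) :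
    rescale U ε = U (1 / ε) ∘ stretch ε hε := by
  funext y
  simp [rescale, stretch_apply]

/-- No differentiability is needed, as the change of variables is a linear isomorphism. -/
lemma pd_rescale (U : ℝ → Loc → Vec N) {ε : ℝ} (hε : ε ≠ 0) (e : Loc) :
    pd e (rescale U ε) = rescale (fun s => pd (ε * e.1, e.2) (U s)) ε := by
  funext y
  have h : fderiv ℝ (rescale U ε) y =
      (fderiv ℝ (U (1 / ε)) (stretch ε hε y)).comp (stretch ε hε : Loc →L[ℝ] Loc) := by
    rw [rescale_eq_comp_stretch U hε]
    exact (stretch ε hε).comp_right_fderiv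
  simp [pd, h, rescale, stretch_apply]

lemma dT_rescale (U : ℝ → Loc → Vec N) {ε : ℝ} (hε : ε ≠ 0) (i : Fin 2) :
    dT i (rescale U ε) = rescale (fun s => dT i (U s)) ε := by
  simp [dT, pd_rescale U hε]

lemma dN_rescale (U : ℝ → Loc → Vec N) {ε : ℝ} (hε : ε ≠ 0) :
    dN (rescale U ε) = fun y => ε • rescale (fun s => dN (U s)) ε y := by
  have h : ((ε * 1, 0) : Loc) = ε • (1, 0) := by simp
  simp only [dN, pd_rescale U hε, h, pd_smul_dir]
  rfl

/-- The Laplace-transformed operator in the variables `(η, τ)`, multiplied by `ε²`: normal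
derivatives gain a factor `ε⁻¹`. -/
lemma laplaceOp_rescale (sys : SecondOrderSystem N) (U : ℝ → Loc → Vec N) {ε : ℝ} (hε : ε ≠ 0)
    (η : ℝ) (τ : Tan) :
    ε ^ 2 • sys.laplaceOp (1 / ε) (U (1 / ε)) (ε * η, τ) =
      -rescale U ε (η, τ) + sys.A τ *ᵥ dN (dN (rescale U ε)) (η, τ) +
      ε • ((∑ i, sys.B i τ *ᵥ dT i (dN (rescale U ε)) (η, τ)) +
        sys.C (ε * η, τ) *ᵥ dN (rescale U ε) (η, τ)) +
      ε ^ 2 • ((∑ i, ∑ j, sys.a i j (ε * η, τ) *ᵥ dT i (dT j (rescale U ε)) (η, τ)) +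
        (∑ i, sys.c i (ε * η, τ) *ᵥ dT i (rescale U ε) (η, τ)) +
        sys.d (ε * η, τ) *ᵥ rescale U ε (η, τ)) := by
  have hNN : dN (dN (rescale U ε)) (η, τ) = ε ^ 2 • dN (dN (U (1 / ε))) (ε * η, τ) := by
    rw [dN_rescale U hε]
    have := pd_const_smul ε (1, 0) (rescale (fun s => dN (U s)) ε)
    rw [show dN (fun y => ε • rescale (fun s => dN (U s)) ε y) = _ from this]
    change ε • dN (rescale (fun s => dN (U s)) ε) (η, τ) = _
    rw [dN_rescale _ hε, smul_smul, ← sq]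
    rfl
  have hTN : ∀ i, dT i (dN (rescale U ε)) (η, τ) = ε • dT i (dN (U (1 / ε))) (ε * η, τ) := by
    intro i
    rw [dN_rescale U hε]
    have := pd_const_smul ε (0, tanDir i) (rescale (fun s => dN (U s)) ε)
    rw [show dT i (fun y => ε • rescale (fun s => dN (U s)) ε y) = _ from this]
    change ε • dT i (rescale (fun s => dN (U s)) ε) (η, τ) = _
    rw [dT_rescale _ hε]
    rfl
  have hN : dN (rescale U ε) (η, τ) = ε • dN (U (1 / ε)) (ε * η, τ) := by
    rw [dN_rescale U hε]; rfl
  have hT : ∀ i, dT i (rescale U ε) (η, τ) = dT i (U (1 / ε)) (ε * η, τ) := by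
    intro i; rw [dT_rescale U hε]; rfl
  have hTT : ∀ i j, dT i (dT j (rescale U ε)) (η, τ) = dT i (dT j (U (1 / ε))) (ε * η, τ) := by
    intro i j; rw [dT_rescale U hε, dT_rescale _ hε]; rfl
  have h0 : rescale U ε (η, τ) = U (1 / ε) (ε * η, τ) := rfl
  have h1 : ε ^ 2 * (1 / ε) ^ 2 = 1 := by field_simp
  simp only [SecondOrderSystem.laplaceOp, SecondOrderSystem.spatialOp, hNN, hTN, hN, hT, hTT, h0,
    smul_add, smul_neg, smul_smul, h1, one_smul, Matrix.mulVec_smul, Finset.smul_sum, ← sq]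
  abel

/-! ### Orders in `ε` -/

lemma isLittleO_smul_of_tendsto {F : Filter ℝ} {g : ℝ → Vec N} (hg : Tendsto g F (𝓝 0)) :
    (fun ε => ε • g ε) =o[F] fun ε : ℝ => ε := by
  have := (isBigO_refl (fun ε : ℝ => ε) F).smul_isLittleO ((isLittleO_one_iff ℝ).2 hg)
  simpa using this

lemma tendsto_of_isLittleO_smul {g : ℝ → Vec N}
    (hg : (fun ε => ε • g ε) =o[𝓝[>] 0] fun ε : ℝ => ε) : Tendsto g (𝓝[>] 0) (𝓝 0) := by
  have h := (isBigO_refl (fun ε : ℝ => ε⁻¹) (𝓝[>] 0)).smul_isLittleO hg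
  refine (isLittleO_one_iff ℝ).1 (h.congr' ?_ ?_)
  · filter_upwards [self_mem_nhdsWithin] with ε hε
    rw [smul_smul, inv_mul_cancel₀ (ne_of_gt hε), one_smul]
  · filter_upwards [self_mem_nhdsWithin] with ε hε
    rw [smul_eq_mul, inv_mul_cancel₀ (ne_of_gt hε)]

lemma tendsto_of_expansion {f : ℝ → Vec N} {a b : Vec N}
    (h : (fun ε => f ε - a - ε • b) =o[𝓝[>] 0] fun ε : ℝ => ε) : Tendsto f (𝓝[>] 0) (𝓝 a) := by
  have hid : Tendsto (fun ε : ℝ => ε) (𝓝[>] 0) (𝓝 0) := tendsto_id.mono_left nhdsWithin_le_nhds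
  have h1 := (h.isBigO.trans_tendsto hid).add ((hid.smul_const b).add_const a)
  simp only [zero_smul, zero_add] at h1
  refine h1.congr fun ε => ?_
  abel

lemma eq_zero_of_isLittleO {a b : Vec N}
    (h : (fun ε : ℝ => a + ε • b) =o[𝓝[>] 0] fun ε : ℝ => ε) : a = 0 ∧ b = 0 := by
  have ha : a = 0 := by
    have : Tendsto (fun _ : ℝ => (0 : Vec N)) (𝓝[>] 0) (𝓝 a) := by
      refine tendsto_of_expansion (b := b) (h.neg_left.congr_left fun ε => ?_)
      abel
    exact tendsto_nhds_unique this tendsto_const_nhds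
  subst ha
  simp only [zero_add] at h
  exact ⟨rfl, tendsto_nhds_unique tendsto_const_nhds (tendsto_of_isLittleO_smul h)⟩

lemma isLittleO_mulVec {F : Filter ℝ} (M : Mat N) {f : ℝ → Vec N} {g : ℝ → ℝ} (h : f =o[F] g) :
    (fun ε => M *ᵥ f ε) =o[F] g :=
  ((LinearMap.toContinuousLinearMap (Matrix.mulVecLin M)).isBigO_comp f F).trans_isLittleO h

lemma tendsto_mulVec₂ {ι : Type*} {F : Filter ι} {M : ι → Mat N} {M₀ : Mat N} {f : ι → Vec N}
    {f₀ : Vec N} (hM : Tendsto M F (𝓝 M₀)) (hf : Tendsto f F (𝓝 f₀)) :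
    Tendsto (fun y => M y *ᵥ f y) F (𝓝 (M₀ *ᵥ f₀)) :=
  ((Continuous.matrix_mulVec continuous_fst continuous_snd :
    Continuous fun p : Mat N × Vec N => p.1 *ᵥ p.2).tendsto (M₀, f₀)).comp (hM.prodMk_nhds hf)

/-! ### The equations for the profiles -/

/-- The coefficients that depend on `(n, τ)` are continuous at `x`. This is all that the expansion in
`ε` needs of them, since they are evaluated at `(ε η, τ)`. -/
def SecondOrderSystem.ContAt (sys : SecondOrderSystem N) (x : Loc) : Prop :=
  ContinuousAt sys.C x ∧ (∀ i j, ContinuousAt (sys.a i j) x) ∧ (∀ i, ContinuousAt (sys.c i) x) ∧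
    ContinuousAt sys.d x

lemma SmoothMatAt.eventually_continuousAt {E : Type*} [NormedAddCommGroup E] [NormedSpace ℝ E]
    {M : E → Mat N} {x : E} (h : SmoothMatAt M x) : ∀ᶠ y in 𝓝 x, ContinuousAt M y := by
  have : ∀ᶠ y in 𝓝 x, ∀ j k, ContDiffAt ℝ 1 (fun y => M y j k) y :=
    eventually_all.2 fun j => eventually_all.2 fun k =>
      ((h j k).of_le (by simp)).eventually (by simp)
  filter_upwards [this] with y hy
  exact continuousAt_pi.2 fun j => continuousAt_pi.2 fun k => (hy j k).continuousAt

lemma SecondOrderSystem.SmoothAt.eventually_contAt {sys : SecondOrderSystem N} {O : Tan}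
    (h : sys.SmoothAt O) : ∀ᶠ τ in 𝓝 O, sys.ContAt (0, τ) := by
  have hc : Tendsto (fun τ : Tan => ((0, τ) : Loc)) (𝓝 O) (𝓝 (0, O)) :=
    (Continuous.prodMk_right (0 : ℝ)).tendsto O
  have h2 : ∀ᶠ x in 𝓝 ((0, O) : Loc), sys.ContAt x :=
    (SmoothMatAt.eventually_continuousAt h.2.2.1).and
      ((eventually_all.2 fun i => eventually_all.2 fun j =>
        SmoothMatAt.eventually_continuousAt (h.2.2.2.1 i j)).and
      ((eventually_all.2 fun i => SmoothMatAt.eventually_continuousAt (h.2.2.2.2.1 i)).and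
        (SmoothMatAt.eventually_continuousAt h.2.2.2.2.2)))
  exact hc.eventually h2

/-- The equation of order `ε⁰`: `-v + A v_ηη`. -/
noncomputable def SecondOrderSystem.order0 (sys : SecondOrderSystem N) (v : Loc → Vec N) (y : Loc) :
    Vec N :=
  -v y + sys.A y.2 *ᵥ dN (dN v) y

/-- The equation of order `ε¹`: `-w + A w_ηη + (B∇_τ) v_η + C₀ v_η`. -/
noncomputable def SecondOrderSystem.order1 (sys : SecondOrderSystem N) (v w : Loc → Vec N) (y : Loc) :
    Vec N :=
  -w y + sys.A y.2 *ᵥ dN (dN w) y + ((∑ i, sys.B i y.2 *ᵥ dT i (dN v) y) +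
    sys.C (0, y.2) *ᵥ dN v y)

variable {sys : SecondOrderSystem N} {δ : ℝ} {W : Set Tan} {U : ℝ → Loc → Vec N} {v w : Loc → Vec N}

lemma HasOutgoingExpansion.laplaceOp_expansion (h : HasOutgoingExpansion δ W U v w) {η : ℝ}
    (hη : 0 ≤ η) {τ : Tan} (hτ : τ ∈ W) (hc : sys.ContAt (0, τ)) :
    (fun ε => ε ^ 2 • sys.laplaceOp (1 / ε) (U (1 / ε)) (ε * η, τ) -
      (sys.order0 v (η, τ) + ε • sys.order1 v w (η, τ))) =o[𝓝[>] 0] fun ε : ℝ => ε := by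
  have hid : Tendsto (fun ε : ℝ => ε) (𝓝[>] 0) (𝓝 0) := tendsto_id.mono_left nhdsWithin_le_nhds
  have hx : Tendsto (fun ε : ℝ => ((ε * η, τ) : Loc)) (𝓝[>] 0) (𝓝 (0, τ)) := by
    have := (hid.mul_const η).prodMk_nhds (tendsto_const_nhds (x := τ))
    rwa [zero_mul] at this
  have hu := h.expand η hη τ hτ
  have hNN := h.expand_pd_pd (1, 0) (1, 0) η hη τ hτ
  have hN := tendsto_of_expansion (h.expand_pd (1, 0) η hη τ hτ)
  have hT := fun i : Fin 2 => tendsto_of_expansion (h.expand_pd (0, tanDir i) η hη τ hτ)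
  have hTN := fun i : Fin 2 =>
    tendsto_of_expansion (h.expand_pd_pd (0, tanDir i) (1, 0) η hη τ hτ)
  have hTT := fun i j : Fin 2 =>
    tendsto_of_expansion (h.expand_pd_pd (0, tanDir i) (0, tanDir j) η hη τ hτ)
  have h1 : Tendsto (fun ε : ℝ => ((∑ i, sys.B i τ *ᵥ dT i (dN (rescale U ε)) (η, τ)) +
      sys.C (ε * η, τ) *ᵥ dN (rescale U ε) (η, τ)) -
      ((∑ i, sys.B i τ *ᵥ dT i (dN v) (η, τ)) + sys.C (0, τ) *ᵥ dN v (η, τ))) (𝓝[>] 0) (𝓝 0) := by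
    rw [← sub_self ((∑ i, sys.B i τ *ᵥ dT i (dN v) (η, τ)) + sys.C (0, τ) *ᵥ dN v (η, τ))]
    exact ((tendsto_finsetSum _ fun i _ => tendsto_mulVec _ (hTN i)).add
      (tendsto_mulVec₂ (hc.1.tendsto.comp hx) hN)).sub_const _
  have h2 : Tendsto (fun ε : ℝ =>
      ((∑ i, ∑ j, sys.a i j (ε * η, τ) *ᵥ dT i (dT j (rescale U ε)) (η, τ)) +
        (∑ i, sys.c i (ε * η, τ) *ᵥ dT i (rescale U ε) (η, τ)) +
        sys.d (ε * η, τ) *ᵥ rescale U ε (η, τ))) (𝓝[>] 0)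
      (𝓝 ((∑ i, ∑ j, sys.a i j (0, τ) *ᵥ dT i (dT j v) (η, τ)) +
        (∑ i, sys.c i (0, τ) *ᵥ dT i v (η, τ)) + sys.d (0, τ) *ᵥ v (η, τ))) :=
    (((tendsto_finsetSum _ fun i _ => tendsto_finsetSum _ fun j _ =>
      tendsto_mulVec₂ ((hc.2.1 i j).tendsto.comp hx) (hTT i j)).add
      (tendsto_finsetSum _ fun i _ => tendsto_mulVec₂ ((hc.2.2.1 i).tendsto.comp hx) (hT i))).add
      (tendsto_mulVec₂ (hc.2.2.2.tendsto.comp hx) (tendsto_of_expansion hu)))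
  have h2' := hid.smul h2
  rw [zero_smul] at h2'
  -- The leading terms need the full expansion; in the terms with a factor `ε` or `ε²`, convergence of
  -- the derivatives is enough.
  have h3 := (hu.neg_left.add (isLittleO_mulVec (sys.A τ) hNN)).add
    ((isLittleO_smul_of_tendsto h1).add (isLittleO_smul_of_tendsto h2'))
  refine h3.congr' ?_ (Eventually.of_forall fun _ => rfl)
  filter_upwards [self_mem_nhdsWithin] with ε hε
  rw [laplaceOp_rescale sys U (ne_of_gt hε)]
  simp only [SecondOrderSystem.order0, SecondOrderSystem.order1, dN, dT, Matrix.mulVec_sub,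
    Matrix.mulVec_smul, smul_add, smul_sub, smul_neg, smul_smul, ← sq]
  abel

/-- Solutions up to `o(ε)` are the families whose profiles solve the two leading equations. -/
lemma HasOutgoingExpansion.isLittleO_laplaceOp_iff (h : HasOutgoingExpansion δ W U v w) {η : ℝ}
    (hη : 0 ≤ η) {τ : Tan} (hτ : τ ∈ W) (hc : sys.ContAt (0, τ)) :
    ((fun ε => ε ^ 2 • sys.laplaceOp (1 / ε) (U (1 / ε)) (ε * η, τ)) =o[𝓝[>] 0] fun ε : ℝ => ε) ↔
      sys.order0 v (η, τ) = 0 ∧ sys.order1 v w (η, τ) = 0 := by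
  have h1 := h.laplaceOp_expansion hη hτ hc
  constructor
  · intro h2
    exact eq_zero_of_isLittleO ((h2.sub h1).congr_left fun ε => sub_sub_cancel _ _)
  · rintro ⟨h2, h3⟩
    simpa only [h2, h3, smul_zero, add_zero, sub_zero] using h1

/-! ### The boundary symbol -/

lemma fderiv_slice {f : Loc → Vec N} {η : ℝ} {τ : Tan} (hf : DifferentiableAt ℝ f (η, τ))
    (e : Tan) : fderiv ℝ (fun τ' => f (η, τ')) τ e = pd (0, e) f (η, τ) := by
  have := (hf.hasFDerivAt.comp τ (hasFDerivAt_prodMk_right η τ)).fderiv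
  change fderiv ℝ (f ∘ fun τ' => (η, τ')) τ e = _
  rw [this]
  simp [pd]

lemma TanOp.app_slice (P : TanOp N) {f : Loc → Vec N} {η : ℝ} {τ : Tan}
    (hf : DifferentiableAt ℝ f (η, τ)) :
    P.app (fun τ' => f (η, τ')) τ = P.p *ᵥ f (η, τ) + ∑ i, P.q i *ᵥ dT i f (η, τ) := by
  simp only [TanOp.app, fderiv_slice hf, dT]

lemma HasOutgoingExpansion.app_expansion (h : HasOutgoingExpansion δ W U v w) {τ : Tan}
    (hτ : τ ∈ W) (P : TanOp N) :
    (fun ε => (P.p *ᵥ rescale U ε (0, τ) + ∑ i, P.q i *ᵥ dT i (rescale U ε) (0, τ)) -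
      (P.p *ᵥ v (0, τ) + ∑ i, P.q i *ᵥ dT i v (0, τ)) -
      ε • (P.p *ᵥ w (0, τ) + ∑ i, P.q i *ᵥ dT i w (0, τ))) =o[𝓝[>] 0] fun ε : ℝ => ε := by
  have h1 := (isLittleO_mulVec P.p (h.expand 0 le_rfl τ hτ)).add
    (IsLittleO.fun_sum (s := Finset.univ) fun (i : Fin 2) _ =>
      isLittleO_mulVec (P.q i) (h.expand_pd (0, tanDir i) 0 le_rfl τ hτ))
  refine h1.congr_left fun ε => ?_
  simp only [dT, Matrix.mulVec_sub, Matrix.mulVec_smul, smul_add, Finset.sum_sub_distrib,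
    Finset.smul_sum]
  abel

/-- The boundary symbol tends to zero if and only if its two leading orders, in terms of the
profiles, vanish. -/
lemma HasOutgoingExpansion.tendsto_symbol_iff (h : HasOutgoingExpansion δ W U v w) (hδ : 0 < δ)
    (hW : IsOpen W) {O : Tan} (hO : O ∈ W) (P₁ P₀ : TanOp N) :
    Tendsto (fun s => s • P₁.app (fun τ => U s (0, τ)) O - dN (U s) (0, O) +
      P₀.app (fun τ => U s (0, τ)) O) atTop (𝓝 0) ↔
    P₁.app (fun τ => v (0, τ)) O - dN v (0, O) = 0 ∧
      P₁.app (fun τ => w (0, τ)) O - dN w (0, O) + P₀.app (fun τ => v (0, τ)) O = 0 := by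
  have hopen : univ ×ˢ W ∈ 𝓝 ((0, O) : Loc) := prod_mem_nhds univ_mem (hW.mem_nhds hO)
  have hvd : DifferentiableAt ℝ v (0, O) :=
    (h.smooth_v.contDiffAt hopen).differentiableAt (by simp)
  have hwd : DifferentiableAt ℝ w (0, O) :=
    (h.smooth_w.contDiffAt hopen).differentiableAt (by simp)
  set f : ℝ → Vec N := fun s => s • P₁.app (fun τ => U s (0, τ)) O - dN (U s) (0, O) +
      P₀.app (fun τ => U s (0, τ)) O with hf
  have hinv : ∀ᶠ ε : ℝ in 𝓝[>] 0, ε • f ε⁻¹ =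
      (P₁.p *ᵥ rescale U ε (0, O) + ∑ i, P₁.q i *ᵥ dT i (rescale U ε) (0, O)) -
        dN (rescale U ε) (0, O) +
      ε • (P₀.p *ᵥ rescale U ε (0, O) + ∑ i, P₀.q i *ᵥ dT i (rescale U ε) (0, O)) := by
    filter_upwards [tendsto_inv_nhdsGT_zero.eventually h.smooth, self_mem_nhdsWithin] with ε h1 hε
    have hε' : ε ≠ 0 := ne_of_gt hε
    have hd : DifferentiableAt ℝ (U ε⁻¹) (0, O) :=
      (h1.contDiffAt (prod_mem_nhds (Ioo_mem_nhds (by linarith) hδ)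
        (hW.mem_nhds hO))).differentiableAt (by simp)
    have h2 : rescale U ε (0, O) = U ε⁻¹ (0, O) := by simp [rescale]
    have h3 : dN (rescale U ε) (0, O) = ε • dN (U ε⁻¹) (0, O) := by
      rw [dN_rescale U hε']; simp [rescale]
    have h4 : ∀ i, dT i (rescale U ε) (0, O) = dT i (U ε⁻¹) (0, O) := by
      intro i; rw [dT_rescale U hε']; simp [rescale]
    simp only [hf, TanOp.app_slice _ hd, h2, h3, h4, smul_add, smul_sub, smul_smul,
      mul_inv_cancel₀ hε', one_smul]
  -- `f ε⁻¹` is the symbol at `s = 1 / ε`; multiplied by `ε` it has an expansion up to `o(ε)`.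
  have hkey : (fun ε : ℝ => ε • f ε⁻¹ - ((P₁.app (fun τ => v (0, τ)) O - dN v (0, O)) +
      ε • (P₁.app (fun τ => w (0, τ)) O - dN w (0, O) + P₀.app (fun τ => v (0, τ)) O)))
      =o[𝓝[>] 0] fun ε : ℝ => ε := by
    have h1 := h.app_expansion hO P₁
    have h2 := h.expand_pd (1, 0) 0 le_rfl O hO
    have h3 := tendsto_of_expansion (h.app_expansion hO P₀)
    have h4 := h3.sub_const (P₀.p *ᵥ v (0, O) + ∑ i, P₀.q i *ᵥ dT i v (0, O))
    rw [sub_self] at h4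
    refine ((h1.sub h2).add (isLittleO_smul_of_tendsto h4)).congr' ?_
      (Eventually.of_forall fun _ => rfl)
    filter_upwards [hinv] with ε hε
    rw [hε, TanOp.app_slice _ hvd, TanOp.app_slice _ hwd, TanOp.app_slice _ hvd]
    simp only [dN, smul_add, smul_sub]
    abel
  constructor
  · intro ht
    have h1 := isLittleO_smul_of_tendsto (ht.comp tendsto_inv_nhdsGT_zero)
    exact eq_zero_of_isLittleO ((h1.sub hkey).congr_left fun ε => sub_sub_cancel _ _)
  · rintro ⟨h1, h2⟩
    simp only [h1, h2, smul_zero, add_zero, sub_zero] at hkey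
    have := (tendsto_of_isLittleO_smul hkey).comp tendsto_inv_atTop_nhdsGT_zero
    refine this.congr fun s => ?_
    simp

end Profiles

section OneWay

/-! ### Outgoing profiles satisfy the transparent boundary conditions -/

lemma hasDerivAt_dN {f : Loc → Vec N} {η : ℝ} {τ : Tan} (hf : DifferentiableAt ℝ f (η, τ)) :
    HasDerivAt (fun y => f (y, τ)) (dN f (η, τ)) η := by
  refine (hf.hasFDerivAt.comp η (hasFDerivAt_prodMk_left η τ)).hasDerivAt.congr_deriv ?_
  simp [dN, pd]

lemma contDiffAt_pd {f : Loc → Vec N} {x : Loc} (hf : ContDiffAt ℝ 2 f x) (e : Loc) :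
    ContDiffAt ℝ 1 (pd e f) x :=
  (hf.fderiv_right (m := 1) (by norm_num)).clm_apply contDiffAt_const

lemma differentiableAt_pd {f : Loc → Vec N} {x : Loc} (hf : ContDiffAt ℝ 2 f x) (e : Loc) :
    DifferentiableAt ℝ (pd e f) x :=
  (contDiffAt_pd hf e).differentiableAt (by simp)

lemma pd_pd_apply {f : Loc → Vec N} {x : Loc} (hf : ContDiffAt ℝ 2 f x) (e e' : Loc) :
    pd e (pd e' f) x = fderiv ℝ (fderiv ℝ f) x e e' := by
  have h : DifferentiableAt ℝ (fderiv ℝ f) x :=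
    (hf.fderiv_right (m := 1) (by norm_num)).differentiableAt (by simp)
  have h1 : HasFDerivAt (pd e' f) ((fderiv ℝ (fderiv ℝ f) x).flip e') x := by
    have := h.hasFDerivAt.clm_apply (hasFDerivAt_const e' x)
    refine this.congr_fderiv ?_
    rw [ContinuousLinearMap.comp_zero, zero_add]
  rw [pd, h1.fderiv]
  rfl

lemma pd_comm {f : Loc → Vec N} {x : Loc} (hf : ContDiffAt ℝ 2 f x) (e e' : Loc) :
    pd e (pd e' f) x = pd e' (pd e f) x := by
  rw [pd_pd_apply hf, pd_pd_apply hf]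
  exact hf.isSymmSndFDerivAt (by simp) e e'

/-- The Sylvester equation applied to a function with value `x` and first derivatives `y i`. -/
lemma SylvesterCoeffs.apply {sys : SecondOrderSystem N} {S : Tan → Mat N} {τ : Tan} {P : TanOp N}
    (h : SylvesterCoeffs sys S τ P) (hS : S τ * S τ * sys.A τ = 1) (x : Vec N)
    (y : Fin 2 → Vec N) :
    S τ *ᵥ (S τ *ᵥ ((∑ i, sys.B i τ *ᵥ (-(dMat i S τ *ᵥ x + S τ *ᵥ y i))) +
      sys.C (0, τ) *ᵥ (-(S τ *ᵥ x)))) =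
    S τ *ᵥ (P.p *ᵥ x + ∑ i, P.q i *ᵥ y i) +
      (P.p *ᵥ (S τ *ᵥ x) + ∑ i, P.q i *ᵥ (dMat i S τ *ᵥ x + S τ *ᵥ y i)) := by
  have hinv : (sys.A τ)⁻¹ = S τ * S τ := Matrix.inv_eq_left_inv hS
  have hq := fun i => congrArg (fun M => M *ᵥ y i) (h.1 i)
  have hp := congrArg (fun M => M *ᵥ x) (h.2)
  have hq0 := hq 0
  have hq1 := hq 1
  rw [hinv] at hp hq0 hq1
  simp only [Fin.sum_univ_two, Matrix.add_mulVec, Matrix.neg_mulVec, Matrix.sub_mulVec,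
    Matrix.mul_add, ← Matrix.mulVec_mulVec, Matrix.mulVec_add, Matrix.mulVec_neg] at hp hq0 hq1 ⊢
  rw [← sub_eq_zero] at hp hq0 hq1 ⊢
  have h3 := congrArg₂ (· + ·) hp (congrArg₂ (· + ·) hq0 hq1)
  simp only [add_zero] at h3
  rw [← neg_eq_zero, ← h3]
  abel

variable {sys : SecondOrderSystem N} {S : Tan → Mat N} {W : Set Tan} {v w : Loc → Vec N}

lemma order0_eq_zero_iff {y : Loc} (hS : S y.2 * S y.2 * sys.A y.2 = 1) :
    sys.order0 v y = 0 ↔ dN (dN v) y = S y.2 *ᵥ (S y.2 *ᵥ v y) := by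
  have hS' : sys.A y.2 * (S y.2 * S y.2) = 1 := mul_eq_one_comm.1 hS
  rw [SecondOrderSystem.order0, neg_add_eq_zero]
  constructor
  · intro h
    rw [h, Matrix.mulVec_mulVec, Matrix.mulVec_mulVec, hS, Matrix.one_mulVec]
  · intro h
    rw [h, Matrix.mulVec_mulVec, Matrix.mulVec_mulVec, mul_assoc, hS', Matrix.one_mulVec]

lemma order1_eq_zero_iff {y : Loc} (hS : S y.2 * S y.2 * sys.A y.2 = 1) :
    sys.order1 v w y = 0 ↔ dN (dN w) y = S y.2 *ᵥ (S y.2 *ᵥ w y) -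
      S y.2 *ᵥ (S y.2 *ᵥ ((∑ i, sys.B i y.2 *ᵥ dT i (dN v) y) + sys.C (0, y.2) *ᵥ dN v y)) := by
  have hS' : sys.A y.2 * (S y.2 * S y.2) = 1 := mul_eq_one_comm.1 hS
  set F := (∑ i, sys.B i y.2 *ᵥ dT i (dN v) y) + sys.C (0, y.2) *ᵥ dN v y with hF
  have h0 : sys.order1 v w y = sys.A y.2 *ᵥ dN (dN w) y - (w y - F) := by
    rw [SecondOrderSystem.order1, ← hF]; abel
  rw [h0, sub_eq_zero, ← Matrix.mulVec_sub, ← Matrix.mulVec_sub]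
  constructor
  · intro h
    rw [← h, Matrix.mulVec_mulVec, Matrix.mulVec_mulVec, hS, Matrix.one_mulVec]
  · intro h
    rw [h, Matrix.mulVec_mulVec, Matrix.mulVec_mulVec, mul_assoc, hS', Matrix.one_mulVec]

/-- The leading profile of an outgoing family solves the one-way equation `v_η = -S v`. -/
lemma dN_eq_of_order0 {τ : Tan} (hv : ∀ η, ContDiffAt ℝ 2 v (η, τ))
    (hv0 : Tendsto (fun η => v (η, τ)) atTop (𝓝 0)) (hS : S τ * S τ * sys.A τ = 1)
    (hs : HasSimplePosSpectrum (S τ)) (h : ∀ η, 0 ≤ η → sys.order0 v (η, τ) = 0) {η : ℝ}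
    (hη : 0 ≤ η) : dN v (η, τ) = -(S τ *ᵥ v (η, τ)) := by
  have hd := fun η => hasDerivAt_dN ((hv η).differentiableAt (by simp))
  have hdd := fun η => hasDerivAt_dN (differentiableAt_pd (hv η) (1, 0))
  have := hs.residual_eq_zero (w := fun η => v (η, τ)) (w' := fun η => dN v (η, τ))
    (h := fun _ => 0) (fun η _ => hd η) (fun η hη => ?_) hv0 tendsto_const_nhds hη
  · simpa using this
  · refine (((hdd η).add (hasDerivAt_mulVec (S τ) (hd η))).sub_const 0).congr_deriv ?_
    have := (order0_eq_zero_iff (y := (η, τ)) hS).1 (h η hη)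
    rw [show pd (1, 0) v = dN v from rfl, this, sub_zero, Matrix.mulVec_add, add_comm]

/-- The tangential derivatives of the leading profile: `∂_η ∂_τ v = -(∂_τ S) v - S ∂_τ v`. -/
lemma dT_dN_eq_of_one_way {O : Tan} {η : ℝ}
    (hS : ∀ j k, DifferentiableAt ℝ (fun y => S y j k) O) (hv : ContDiffAt ℝ 2 v (η, O))
    (h : ∀ᶠ τ in 𝓝 O, dN v (η, τ) = -(S τ *ᵥ v (η, τ))) (i : Fin 2) :
    dT i (dN v) (η, O) = -(dMat i S O *ᵥ v (η, O) + S O *ᵥ dT i v (η, O)) := by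
  have hvd : DifferentiableAt ℝ v (η, O) := hv.differentiableAt (by simp)
  have hvs : DifferentiableAt ℝ (fun τ => v (η, τ)) O :=
    hvd.comp O (hasFDerivAt_prodMk_right η O).differentiableAt
  have h1 : (fun τ => dN v (η, τ)) =ᶠ[𝓝 O] fun τ => -(S τ *ᵥ v (η, τ)) := h
  rw [dT, ← fderiv_slice (f := dN v) (differentiableAt_pd hv (1, 0)), h1.fderiv_eq, fderiv_fun_neg, _root_.neg_apply, fderiv_mulVec hS hvs,
    fderiv_slice hvd]
  rfl

/-- The first-order profile of an outgoing family satisfies `w_η = -S w + P v`, where `P` solves the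
Sylvester equation: that equation turns the residual `z = w_η + S w - P v` into a solution of
`z_η = S z`. -/
lemma dN_eq_of_order1 {O : Tan} {P : TanOp N} (hS : SmoothMatAt S O)
    (hSA : ∀ᶠ τ in 𝓝 O, S τ * S τ * sys.A τ = 1 ∧ HasSimplePosSpectrum (S τ))
    (hP : SylvesterCoeffs sys S O P) (hW : IsOpen W) (hO : O ∈ W)
    (hv : ContDiffOn ℝ 2 v (univ ×ˢ W)) (hw : ContDiffOn ℝ 2 w (univ ×ˢ W))
    (hv0 : ∀ τ ∈ W, Tendsto (fun η => v (η, τ)) atTop (𝓝 0))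
    (hw0 : ∀ τ ∈ W, Tendsto (fun η => w (η, τ)) atTop (𝓝 0))
    (h0 : ∀ᶠ τ in 𝓝 O, ∀ η, 0 ≤ η → sys.order0 v (η, τ) = 0)
    (h1 : ∀ η, 0 ≤ η → sys.order1 v w (η, O) = 0) {η : ℝ} (hη : 0 ≤ η) :
    dN w (η, O) = -(S O *ᵥ w (η, O)) + (P.p *ᵥ v (η, O) + ∑ i, P.q i *ᵥ dT i v (η, O)) := by
  obtain ⟨hSO, hs⟩ := hSA.self_of_nhds
  have hnhds : ∀ η, ∀ τ ∈ W, univ ×ˢ W ∈ 𝓝 ((η, τ) : Loc) := fun η τ hτ =>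
    prod_mem_nhds univ_mem (hW.mem_nhds hτ)
  have hvO : ∀ η, ContDiffAt ℝ 2 v (η, O) := fun η => hv.contDiffAt (hnhds η O hO)
  have hwO : ∀ η, ContDiffAt ℝ 2 w (η, O) := fun η => hw.contDiffAt (hnhds η O hO)
  have hv1 : ∀ᶠ τ in 𝓝 O, ∀ η, 0 ≤ η → dN v (η, τ) = -(S τ *ᵥ v (η, τ)) := by
    filter_upwards [hSA, h0, hW.mem_nhds hO] with τ hτ1 hτ2 hτ η hη
    exact dN_eq_of_order0 (fun η => hv.contDiffAt (hnhds η τ hτ)) (hv0 τ hτ) hτ1.1 hτ1.2 hτ2 hη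
  have hv1O := hv1.self_of_nhds
  have hTN : ∀ i, ∀ η, 0 ≤ η → dT i (dN v) (η, O) =
      -(dMat i S O *ᵥ v (η, O) + S O *ᵥ dT i v (η, O)) := fun i η hη =>
    dT_dN_eq_of_one_way
      (fun j k => (hS j k).differentiableAt (by simp)) (hvO η) (hv1.mono fun τ hτ => hτ η hη) i
  have hdv : ∀ η, 0 ≤ η → HasDerivAt (fun η => v (η, O)) (-(S O *ᵥ v (η, O))) η := fun η hη =>
    (hasDerivAt_dN ((hvO η).differentiableAt (by simp))).congr_deriv (hv1O η hη)
  have hdT : ∀ i, ∀ η, 0 ≤ η → HasDerivAt (fun η => dT i v (η, O))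
      (-(dMat i S O *ᵥ v (η, O) + S O *ᵥ dT i v (η, O))) η := fun i η hη => by
    refine (hasDerivAt_dN (differentiableAt_pd (hvO η) (0, tanDir i))).congr_deriv ?_
    rw [← hTN i η hη]
    exact pd_comm (hvO η) _ _
  have hT0 : ∀ i, Tendsto (fun η => dT i v (η, O)) atTop (𝓝 0) := fun i => by
    refine hs.tendsto_zero (h := fun η => -(dMat i S O *ᵥ v (η, O))) (fun η hη => ?_) ?_
    · refine (hdT i η hη).congr_deriv ?_
      abel
    · simpa using (tendsto_mulVec_zero (dMat i S O) (hv0 O hO)).neg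
  refine hs.residual_eq_zero (w := fun η => w (η, O)) (w' := fun η => dN w (η, O))
    (h := fun η => P.p *ᵥ v (η, O) + ∑ i, P.q i *ᵥ dT i v (η, O))
    (fun η _ => hasDerivAt_dN ((hwO η).differentiableAt (by simp))) (fun η hη => ?_) (hw0 O hO)
    ?_ hη
  · have hd := ((hasDerivAt_dN (differentiableAt_pd (hwO η) (1, 0))).add (hasDerivAt_mulVec (S O)
      (hasDerivAt_dN ((hwO η).differentiableAt (by simp))))).sub
      ((hasDerivAt_mulVec P.p (hdv η hη)).add (HasDerivAt.fun_sum (u := Finset.univ)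
        fun (i : Fin 2) _ => hasDerivAt_mulVec (P.q i) (hdT i η hη)))
    refine hd.congr_deriv ?_
    have h2 := (order1_eq_zero_iff (y := (η, O)) hSO).1 (h1 η hη)
    simp only [hTN _ η hη, hv1O η hη] at h2
    rw [show pd (1, 0) w = dN w from rfl, h2, hP.apply hSO]
    simp only [Matrix.mulVec_add, Matrix.mulVec_sub, Matrix.mulVec_neg, Finset.sum_neg_distrib]
    abel
  · have h3 := (tendsto_mulVec_zero P.p (hv0 O hO)).add
      (tendsto_finsetSum Finset.univ fun i _ => tendsto_mulVec_zero (P.q i) (hT0 i))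
    simpa using h3

lemma TanOp.app_ofMat (M : Mat N) (φ : Tan → Vec N) (O : Tan) :
    (TanOp.ofMat M).app φ O = M *ᵥ φ O := by
  simp [TanOp.app, TanOp.ofMat]

/-- The Sylvester solution gives the differential part of the transparent boundary conditions. -/
lemma isDifferentialPart_of_sylvesterCoeffs {O : Tan} {P : TanOp N} (hsys : sys.SmoothAt O)
    (hS : SmoothMatAt S O)
    (hSA : ∀ᶠ τ in 𝓝 O, S τ * S τ * sys.A τ = 1 ∧ HasSimplePosSpectrum (S τ))
    (hP : SylvesterCoeffs sys S O P) : IsDifferentialPart sys O (TanOp.ofMat (-S O)) P := by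
  intro δ W U v w hδ hW hO h hsol
  have hnhds : univ ×ˢ W ∈ 𝓝 ((0, O) : Loc) := prod_mem_nhds univ_mem (hW.mem_nhds hO)
  have horder : ∀ᶠ τ in 𝓝 O, ∀ η, 0 ≤ η →
      sys.order0 v (η, τ) = 0 ∧ sys.order1 v w (η, τ) = 0 := by
    filter_upwards [hsys.eventually_contAt, hW.mem_nhds hO] with τ hτ1 hτ η hη
    exact (h.isLittleO_laplaceOp_iff hη hτ hτ1).1 (hsol η hη τ hτ)
  rw [h.tendsto_symbol_iff hδ hW hO]
  obtain ⟨hSO, hs⟩ := hSA.self_of_nhds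
  have h1 := dN_eq_of_order0 (fun η => h.smooth_v.contDiffAt
    (prod_mem_nhds univ_mem (hW.mem_nhds hO))) (h.vanish_v O hO) hSO hs
    (fun η hη => (horder.self_of_nhds η hη).1) le_rfl
  have h2 := dN_eq_of_order1 hS hSA hP hW hO h.smooth_v h.smooth_w h.vanish_v h.vanish_w
    (horder.mono fun τ hτ η hη => (hτ η hη).1) (fun η hη => (horder.self_of_nhds η hη).2) le_rfl
  rw [TanOp.app_ofMat, TanOp.app_ofMat, Matrix.neg_mulVec, Matrix.neg_mulVec, h1, h2,
    TanOp.app_slice _ ((h.smooth_v.contDiffAt hnhds).differentiableAt (by simp))]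
  constructor <;> abel

end OneWay

/-! ### Linear flows depending on parameters -/

section Flow

variable {X : Type*} [NormedAddCommGroup X] [NormedSpace ℝ X]

/-- The solution `e^{η L} x` of `Ψ' = L Ψ`, `Ψ(0) = x`, at "time" `η`, for `L` and `x` that depend
on `τ`. -/
noncomputable def flow (L : Tan → X →L[ℝ] X) (x : Tan → X) (y : Loc) : X :=
  NormedSpace.exp (y.1 • L y.2) (x y.2)

lemma contDiffAt_flow [CompleteSpace X] {L : Tan → X →L[ℝ] X} {x : Tan → X} {n : WithTop ℕ∞} {y : Loc}
    (hL : ContDiffAt ℝ n L y.2) (hx : ContDiffAt ℝ n x y.2) : ContDiffAt ℝ n (flow L x) y := by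
  have h1 : ContDiffAt ℝ n (fun y : Loc => y.1 • L y.2) y :=
    contDiffAt_fst.smul (hL.comp y contDiffAt_snd)
  have h2 : ContDiffAt ℝ n (fun y : Loc => NormedSpace.exp (y.1 • L y.2)) y :=
    ((NormedSpace.exp_analytic (𝕂 := ℝ) (y.1 • L y.2)).contDiffAt).comp y h1
  exact h2.clm_apply (hx.comp y contDiffAt_snd)

lemma hasDerivAt_flow [CompleteSpace X] (L : Tan → X →L[ℝ] X) (x : Tan → X) (η : ℝ) (τ : Tan) :
    HasDerivAt (fun η => flow L x (η, τ)) (L τ (flow L x (η, τ))) η := by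
  have h := (hasDerivAt_exp_smul_const' (𝕂 := ℝ) (L τ) η).clm_apply (hasDerivAt_const η (x τ))
  refine h.congr_deriv ?_
  simp [flow]

lemma flow_zero (L : Tan → X →L[ℝ] X) (x : Tan → X) (τ : Tan) : flow L x (0, τ) = x τ := by
  simp [flow]

end Flow

/-- The joint phase space for a profile `v`, its tangential derivatives `y i` and the profile `w`. -/
abbrev Jet (N : ℕ) := Vec N × (Fin 2 → Vec N) × Vec N

/-- The right-hand side of the triangular system
`v' = -S v`, `y_i' = -(D_i v + S y_i)`, `w' = -S w + (p v + Σ q_i y_i)`. -/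
noncomputable def jetOp (S : Mat N) (D : Fin 2 → Mat N) (P : TanOp N) : Jet N →L[ℝ] Jet N :=
  LinearMap.toContinuousLinearMap
    { toFun := fun x => (-(S *ᵥ x.1), fun i => -(D i *ᵥ x.1 + S *ᵥ x.2.1 i),
        -(S *ᵥ x.2.2) + (P.p *ᵥ x.1 + ∑ i, P.q i *ᵥ x.2.1 i))
      map_add' := fun x y => by
        ext <;> simp [Matrix.mulVec_add, add_assoc, add_comm, add_left_comm, Finset.sum_add_distrib]
      map_smul' := fun c x => by
        ext <;> (simp [Matrix.mulVec_smul]; try ring) }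

lemma jetOp_apply (S : Mat N) (D : Fin 2 → Mat N) (P : TanOp N) (x : Jet N) :
    jetOp S D P x = (-(S *ᵥ x.1), fun i => -(D i *ᵥ x.1 + S *ᵥ x.2.1 i),
        -(S *ᵥ x.2.2) + (P.p *ᵥ x.1 + ∑ i, P.q i *ᵥ x.2.1 i)) := rfl

/-- On a finite-dimensional space, smoothness of an operator-valued function is smoothness of its
values on each vector. -/
lemma contDiffAt_clm_of_apply {E X Y : Type*} [NormedAddCommGroup E] [NormedSpace ℝ E]
    [NormedAddCommGroup X] [NormedSpace ℝ X] [FiniteDimensional ℝ X] [NormedAddCommGroup Y]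
    [NormedSpace ℝ Y] {n : WithTop ℕ∞} {L : E → X →L[ℝ] Y} {e : E}
    (h : ∀ x, ContDiffAt ℝ n (fun e => L e x) e) : ContDiffAt ℝ n L e := by
  let d := Module.finrank ℝ X
  have hd : d = Module.finrank ℝ (Fin d → ℝ) := (Module.finrank_fin_fun ℝ).symm
  let e₁ := ContinuousLinearEquiv.ofFinrankEq hd
  let e₂ := (e₁.arrowCongr (1 : Y ≃L[ℝ] Y)).trans (ContinuousLinearEquiv.piRing (Fin d))
  rw [← Function.id_comp L, ← e₂.symm_comp_self]
  exact e₂.symm.contDiff.contDiffAt.comp e (contDiffAt_pi.mpr fun i => h _)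

lemma contDiffAt_jetOp {n : WithTop ℕ∞} {S p : Tan → Mat N} {D q : Fin 2 → Tan → Mat N} {τ : Tan}
    (hS : ∀ j k, ContDiffAt ℝ n (fun t => S t j k) τ)
    (hD : ∀ i j k, ContDiffAt ℝ n (fun t => D i t j k) τ)
    (hp : ∀ j k, ContDiffAt ℝ n (fun t => p t j k) τ)
    (hq : ∀ i j k, ContDiffAt ℝ n (fun t => q i t j k) τ) :
    ContDiffAt ℝ n (fun t => jetOp (S t) (fun i => D i t) ⟨p t, fun i => q i t⟩) τ := by
  refine contDiffAt_clm_of_apply fun x => ?_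
  simp only [jetOp_apply]
  refine (contDiffAt_mulVec hS contDiffAt_const).neg.prodMk
    ((contDiffAt_pi.2 fun i => ((contDiffAt_mulVec (hD i) contDiffAt_const).add
      (contDiffAt_mulVec hS contDiffAt_const)).neg).prodMk ?_)
  exact (contDiffAt_mulVec hS contDiffAt_const).neg.add
    ((contDiffAt_mulVec hp contDiffAt_const).add
      (ContDiffAt.sum fun i _ => contDiffAt_mulVec (hq i) contDiffAt_const))

/-! ### Families with prescribed profiles -/

/-- The family with the exact expansion `ũ = v + ε w`. -/
noncomputable def profileFamily (v w : Loc → Vec N) (s : ℝ) (x : Loc) : Vec N :=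
  v (s * x.1, x.2) + s⁻¹ • w (s * x.1, x.2)

lemma rescale_profileFamily (v w : Loc → Vec N) {ε : ℝ} (hε : ε ≠ 0) :
    rescale (profileFamily v w) ε = fun y => v y + ε • w y := by
  funext y
  simp [rescale, profileFamily, hε]

lemma hasOutgoingExpansion_profileFamily (δ : ℝ) {W : Set Tan} (hW : IsOpen W) {v w : Loc → Vec N}
    (hv : ContDiffOn ℝ 2 v (univ ×ˢ W)) (hw : ContDiffOn ℝ 2 w (univ ×ˢ W))
    (hv0 : ∀ τ ∈ W, Tendsto (fun η => v (η, τ)) atTop (𝓝 0))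
    (hw0 : ∀ τ ∈ W, Tendsto (fun η => w (η, τ)) atTop (𝓝 0)) :
    HasOutgoingExpansion δ W (profileFamily v w) v w := by
  have hopen : IsOpen (univ ×ˢ W : Set Loc) := isOpen_univ.prod hW
  have hv' : ∀ y ∈ (univ ×ˢ W : Set Loc), ContDiffAt ℝ 2 v y := fun y hy =>
    hv.contDiffAt (hopen.mem_nhds hy)
  have hw' : ∀ y ∈ (univ ×ˢ W : Set Loc), ContDiffAt ℝ 2 w y := fun y hy =>
    hw.contDiffAt (hopen.mem_nhds hy)
  have hpd : ∀ (e : Loc) (ε : ℝ), ∀ y ∈ (univ ×ˢ W : Set Loc),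
      pd e (fun y => v y + ε • w y) y = pd e v y + ε • pd e w y := by
    intro e ε y hy
    have h1 := (((hv' y hy).differentiableAt (by simp)).hasFDerivAt.add
      (((hw' y hy).differentiableAt (by simp)).hasFDerivAt.const_smul ε)).fderiv
    change fderiv ℝ (v + ε • w) y e = _
    rw [h1]
    rfl
  refine ⟨Eventually.of_forall fun s => ?_, hv, hw, fun η _ τ hτ => ?_, fun e η _ τ hτ => ?_,
    fun e e' η _ τ hτ => ?_, hv0, hw0⟩
  · have hl : ContDiff ℝ 2 (fun x : Loc => ((s * x.1, x.2) : Loc)) := by fun_prop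
    have hm : MapsTo (fun x : Loc => ((s * x.1, x.2) : Loc)) (Ioo (-δ) δ ×ˢ W) (univ ×ˢ W) :=
      fun x hx => ⟨mem_univ _, hx.2⟩
    exact (hv.comp hl.contDiffOn hm).add ((hw.comp hl.contDiffOn hm).const_smul s⁻¹)
  · refine (isLittleO_zero _ _).congr' ?_ EventuallyEq.rfl
    filter_upwards [self_mem_nhdsWithin] with ε hε
    rw [rescale_profileFamily v w (ne_of_gt hε)]
    simp
  · refine (isLittleO_zero _ _).congr' ?_ EventuallyEq.rfl
    filter_upwards [self_mem_nhdsWithin] with ε hε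
    rw [rescale_profileFamily v w (ne_of_gt hε), hpd e ε _ ⟨mem_univ _, hτ⟩]
    simp
  · refine (isLittleO_zero _ _).congr' ?_ EventuallyEq.rfl
    filter_upwards [self_mem_nhdsWithin] with ε hε
    have hy : ((η, τ) : Loc) ∈ (univ ×ˢ W : Set Loc) := ⟨mem_univ _, hτ⟩
    have h1 : pd e' (fun y => v y + ε • w y) =ᶠ[𝓝 (η, τ)] pd e' v + ε • pd e' w := by
      filter_upwards [hopen.mem_nhds hy] with y hy
      rw [hpd e' ε y hy]; rfl
    have h2 := ((differentiableAt_pd (hv' _ hy) e').hasFDerivAt.add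
      ((differentiableAt_pd (hw' _ hy) e').hasFDerivAt.const_smul ε)).fderiv
    rw [rescale_profileFamily v w (ne_of_gt hε), pd_eventuallyEq h1]
    change 0 = fderiv ℝ (pd e' v + ε • pd e' w) (η, τ) e - _ - _
    rw [h2]
    simp [pd]

/-! ### Outgoing families of solutions with arbitrary leading boundary values -/

lemma contDiffAt_matrix_mul {E : Type*} [NormedAddCommGroup E] [NormedSpace ℝ E]
    {n : WithTop ℕ∞} {M K : E → Mat N} {x : E} (hM : ∀ j k, ContDiffAt ℝ n (fun y => M y j k) x)
    (hK : ∀ j k, ContDiffAt ℝ n (fun y => K y j k) x) (j k : Fin N) :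
    ContDiffAt ℝ n (fun y => (M y * K y) j k) x := by
  simp only [Matrix.mul_apply]
  exact ContDiffAt.sum fun l _ => (hM j l).mul (hK l k)

/-- The Sylvester equation can be solved smoothly in a neighbourhood of `O`. -/
lemma exists_smooth_sylvesterCoeffs {sys : SecondOrderSystem N} {S : Tan → Mat N} {O : Tan}
    (hsys : sys.SmoothAt O) (hS : SmoothMatAt S O)
    (hSA : ∀ᶠ τ in 𝓝 O, S τ * S τ * sys.A τ = 1 ∧ HasSimplePosSpectrum (S τ)) :
    ∃ (p : Tan → Mat N) (q : Fin 2 → Tan → Mat N), SmoothMatAt p O ∧ (∀ i, SmoothMatAt (q i) O) ∧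
      ∀ᶠ τ in 𝓝 O, SylvesterCoeffs sys S τ ⟨p τ, fun i => q i τ⟩ := by
  have hs := hSA.self_of_nhds.2
  have hSS : SmoothMatAt (fun τ => S τ * S τ) O := contDiffAt_matrix_mul hS hS
  have hC : SmoothMatAt (fun τ => sys.C (0, τ)) O := fun j k =>
    (hsys.2.2.1 j k).comp O (contDiff_prodMk_right (0 : ℝ)).contDiffAt
  have hq : ∀ i, ∃ Z : Tan → Mat N, SmoothMatAt Z O ∧ ∀ τ, HasSimplePosSpectrum (S τ) →
      S τ * Z τ + Z τ * S τ = -(S τ * S τ * (sys.B i τ * S τ)) := fun i =>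
    exists_contDiffAt_sylvester hS (fun j k =>
      (contDiffAt_matrix_mul hSS (contDiffAt_matrix_mul (hsys.2.1 i) hS) j k).neg) hs
  choose q hq1 hq2 using hq
  have hR : SmoothMatAt (fun τ => -(S τ * S τ * ((∑ i, sys.B i τ * dMat i S τ) +
      sys.C (0, τ) * S τ)) - ∑ i, q i τ * dMat i S τ) O := by
    intro j k
    refine (contDiffAt_matrix_mul hSS (fun j k => ?_) j k).neg.sub ?_
    · simp only [Matrix.add_apply, Matrix.sum_apply]
      exact (ContDiffAt.sum fun i _ =>
        contDiffAt_matrix_mul (hsys.2.1 i) (contDiffAt_dMat hS i) j k).add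
        (contDiffAt_matrix_mul hC hS j k)
    · simp only [Matrix.sum_apply]
      exact ContDiffAt.sum fun i _ => contDiffAt_matrix_mul (hq1 i) (contDiffAt_dMat hS i) j k
  obtain ⟨p, hp1, hp2⟩ := exists_contDiffAt_sylvester hS hR hs
  refine ⟨p, q, hp1, hq1, ?_⟩
  filter_upwards [hSA] with τ hτ
  have hinv : (sys.A τ)⁻¹ = S τ * S τ := Matrix.inv_eq_left_inv hτ.1
  exact ⟨fun i => by rw [hinv]; exact hq2 i τ hτ.2, by rw [hinv]; exact hp2 τ hτ.2⟩

lemma SmoothMatAt.eventually_contDiffAt {E : Type*} [NormedAddCommGroup E] [NormedSpace ℝ E]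
    {M : E → Mat N} {x : E} (h : SmoothMatAt M x) :
    ∀ᶠ y in 𝓝 x, ∀ j k, ContDiffAt ℝ 2 (fun y => M y j k) y :=
  eventually_all.2 fun j => eventually_all.2 fun k =>
    ((h j k).of_le (WithTop.coe_le_coe.2 le_top : ((2 : ℕ∞) : WithTop ℕ∞) ≤ ∞)).eventually (by simp)

/-- For every smooth `φ` there is an outgoing family of solutions whose profiles have the boundary
values `v = φ`, `w = 0`, and the normal derivatives `v_η = -S φ`, `w_η = P φ` at `O`. The profiles
are the components of a triangular linear flow in which the derivatives `∂_τ v` are carried along as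
additional unknowns. -/
lemma exists_outgoing_solution {sys : SecondOrderSystem N} {S : Tan → Mat N} {O : Tan}
    (hsys : sys.SmoothAt O) (hS : SmoothMatAt S O)
    (hSA : ∀ᶠ τ in 𝓝 O, S τ * S τ * sys.A τ = 1 ∧ HasSimplePosSpectrum (S τ)) {P : TanOp N}
    (hP : SylvesterCoeffs sys S O P) {φ : Tan → Vec N} (hφ : ContDiff ℝ ∞ φ) :
    ∃ (W : Set Tan) (U : ℝ → Loc → Vec N) (v w : Loc → Vec N), IsOpen W ∧ O ∈ W ∧
      HasOutgoingExpansion 1 W U v w ∧ SolvesUpToFirstOrder sys W U ∧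
      (∀ τ, v (0, τ) = φ τ) ∧ (∀ τ, w (0, τ) = 0) ∧ dN v (0, O) = -(S O *ᵥ φ O) ∧
      dN w (0, O) = P.app φ O := by
  obtain ⟨p, q, hp, hq, hpq⟩ := exists_smooth_sylvesterCoeffs hsys hS hSA
  have hev : ∀ᶠ τ in 𝓝 O, ((S τ * S τ * sys.A τ = 1 ∧ HasSimplePosSpectrum (S τ)) ∧
      SylvesterCoeffs sys S τ ⟨p τ, fun i => q i τ⟩ ∧ sys.ContAt (0, τ)) ∧
      ((∀ j k, ContDiffAt ℝ 2 (fun t => S t j k) τ) ∧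
      (∀ i j k, ContDiffAt ℝ 2 (fun t => dMat i S t j k) τ)) ∧
      (∀ j k, ContDiffAt ℝ 2 (fun t => p t j k) τ) ∧
      (∀ i j k, ContDiffAt ℝ 2 (fun t => q i t j k) τ) :=
    (hSA.and (hpq.and hsys.eventually_contAt)).and
      ((SmoothMatAt.eventually_contDiffAt hS).and (eventually_all.2 fun i =>
        SmoothMatAt.eventually_contDiffAt (contDiffAt_dMat hS i)) |>.and
      ((SmoothMatAt.eventually_contDiffAt hp).and
        (eventually_all.2 fun i => SmoothMatAt.eventually_contDiffAt (hq i))))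
  obtain ⟨W, hWev, hW, hO⟩ := eventually_nhds_iff.1 hev
  set L : Tan → Jet N →L[ℝ] Jet N := fun τ =>
    jetOp (S τ) (fun i => dMat i S τ) ⟨p τ, fun i => q i τ⟩ with hL
  set x₀ : Tan → Jet N := fun τ => (φ τ, fun i => fderiv ℝ φ τ (tanDir i), 0) with hx₀
  set Ψ : Loc → Jet N := flow L x₀ with hΨ
  set v : Loc → Vec N := fun y => (Ψ y).1 with hv_def
  set w : Loc → Vec N := fun y => (Ψ y).2.2 with hw_def
  have hopen : IsOpen (univ ×ˢ W : Set Loc) := isOpen_univ.prod hW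
  have hx₀s : ContDiff ℝ 2 x₀ := by
    have h1 : ContDiff ℝ 2 (fderiv ℝ φ) := hφ.fderiv_right
      (WithTop.coe_le_coe.2 le_top : ((2 + 1 : ℕ∞) : WithTop ℕ∞) ≤ ∞)
    exact (hφ.of_le (WithTop.coe_le_coe.2 le_top : ((2 : ℕ∞) : WithTop ℕ∞) ≤ ∞)).prodMk
      ((contDiff_pi.2 fun i => h1.clm_apply contDiff_const).prodMk contDiff_const)
  have hΨs : ∀ η, ∀ τ ∈ W, ContDiffAt ℝ 2 Ψ (η, τ) := fun η τ hτ => by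
    obtain ⟨-, ⟨h1, h2⟩, h3, h4⟩ := hWev τ hτ
    exact contDiffAt_flow (contDiffAt_jetOp h1 h2 h3 h4) hx₀s.contDiffAt
  have hvs : ∀ η, ∀ τ ∈ W, ContDiffAt ℝ 2 v (η, τ) := fun η τ hτ => (hΨs η τ hτ).fst
  have hws : ∀ η, ∀ τ ∈ W, ContDiffAt ℝ 2 w (η, τ) := fun η τ hτ => (hΨs η τ hτ).snd.snd
  have hvd : ∀ η τ, HasDerivAt (fun η => v (η, τ)) (-(S τ *ᵥ v (η, τ))) η := fun η τ =>
    (hasDerivAt_flow L x₀ η τ).fst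
  have hyd : ∀ i η τ, HasDerivAt (fun η => (Ψ (η, τ)).2.1 i)
      (-(dMat i S τ *ᵥ v (η, τ) + S τ *ᵥ (Ψ (η, τ)).2.1 i)) η := fun i η τ =>
    hasDerivAt_pi.1 (hasDerivAt_flow L x₀ η τ).snd.fst i
  have hwd : ∀ η τ, HasDerivAt (fun η => w (η, τ)) (-(S τ *ᵥ w (η, τ)) +
      (p τ *ᵥ v (η, τ) + ∑ i, q i τ *ᵥ (Ψ (η, τ)).2.1 i)) η := fun η τ =>
    (hasDerivAt_flow L x₀ η τ).snd.snd
  have hNv : ∀ η, ∀ τ ∈ W, dN v (η, τ) = -(S τ *ᵥ v (η, τ)) := fun η τ hτ =>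
    (hasDerivAt_dN ((hvs η τ hτ).differentiableAt (by simp))).unique (hvd η τ)
  have hNw : ∀ η, ∀ τ ∈ W, dN w (η, τ) = -(S τ *ᵥ w (η, τ)) +
      (p τ *ᵥ v (η, τ) + ∑ i, q i τ *ᵥ (Ψ (η, τ)).2.1 i) := fun η τ hτ =>
    (hasDerivAt_dN ((hws η τ hτ).differentiableAt (by simp))).unique (hwd η τ)
  have hTN : ∀ i η, ∀ τ ∈ W, dT i (dN v) (η, τ) =
      -(dMat i S τ *ᵥ v (η, τ) + S τ *ᵥ dT i v (η, τ)) := fun i η τ hτ =>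
    dT_dN_eq_of_one_way (fun j k => ((hWev τ hτ).2.1.1 j k).differentiableAt (by simp))
      (hvs η τ hτ) (by filter_upwards [hW.mem_nhds hτ] with t ht using hNv η t ht) i
  have hv0 : ∀ τ, v (0, τ) = φ τ := fun τ => by simp [hv_def, hΨ, flow_zero, hx₀]
  have hw0 : ∀ τ, w (0, τ) = 0 := fun τ => by simp [hw_def, hΨ, flow_zero, hx₀]
  -- The middle components are the tangential derivatives of `v`: both solve the same equation.
  have hy : ∀ i, ∀ τ ∈ W, ∀ η, 0 ≤ η → (Ψ (η, τ)).2.1 i = dT i v (η, τ) := by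
    intro i τ hτ η hη
    refine sub_eq_zero.1 ((hWev τ hτ).1.1.2.eq_zero_of_hasDerivAt
      (r := fun η => (Ψ (η, τ)).2.1 i - dT i v (η, τ)) (fun η _ => ?_) ?_ hη)
    · have h1 : HasDerivAt (fun η => dT i v (η, τ))
          (-(dMat i S τ *ᵥ v (η, τ) + S τ *ᵥ dT i v (η, τ))) η := by
        refine (hasDerivAt_dN (differentiableAt_pd (hvs η τ hτ) (0, tanDir i))).congr_deriv ?_
        rw [← hTN i η τ hτ]
        exact pd_comm (hvs η τ hτ) _ _
      refine ((hyd i η τ).sub h1).congr_deriv ?_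
      rw [Matrix.mulVec_sub]
      abel
    · have h1 := fderiv_slice ((hvs 0 τ hτ).differentiableAt (by simp)) (tanDir i)
      simp only [hv0] at h1
      rw [dT, ← h1]
      simp [hΨ, flow_zero, hx₀]
  have hvt : ∀ τ ∈ W, Tendsto (fun η => v (η, τ)) atTop (𝓝 0) := fun τ hτ =>
    (hWev τ hτ).1.1.2.tendsto_zero (h := fun _ => 0)
      (fun η _ => (hvd η τ).congr_deriv (add_zero _).symm) tendsto_const_nhds
  have hyt : ∀ i, ∀ τ ∈ W, Tendsto (fun η => (Ψ (η, τ)).2.1 i) atTop (𝓝 0) := fun i τ hτ => by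
    refine (hWev τ hτ).1.1.2.tendsto_zero (h := fun η => -(dMat i S τ *ᵥ v (η, τ)))
      (fun η _ => (hyd i η τ).congr_deriv (by abel)) ?_
    simpa using (tendsto_mulVec_zero (dMat i S τ) (hvt τ hτ)).neg
  have hwt : ∀ τ ∈ W, Tendsto (fun η => w (η, τ)) atTop (𝓝 0) := fun τ hτ => by
    refine (hWev τ hτ).1.1.2.tendsto_zero (fun η _ => hwd η τ) ?_
    simpa using (tendsto_mulVec_zero (p τ) (hvt τ hτ)).add
      (tendsto_finsetSum Finset.univ fun i _ => tendsto_mulVec_zero (q i τ) (hyt i τ hτ))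
  have hexp : HasOutgoingExpansion 1 W (profileFamily v w) v w :=
    hasOutgoingExpansion_profileFamily 1 hW
      (fun y hy => (hvs y.1 y.2 hy.2).contDiffWithinAt)
      (fun y hy => (hws y.1 y.2 hy.2).contDiffWithinAt) hvt hwt
  refine ⟨W, profileFamily v w, v, w, hW, hO, hexp, fun η hη τ hτ => ?_, hv0, hw0, ?_, ?_⟩
  · obtain ⟨⟨⟨hSO, -⟩, hsyl, hc⟩, -⟩ := hWev τ hτ
    refine (hexp.isLittleO_laplaceOp_iff hη hτ hc).2 ⟨?_, ?_⟩
    · rw [order0_eq_zero_iff (y := (η, τ)) hSO]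
      refine (hasDerivAt_dN (differentiableAt_pd (hvs η τ hτ) (1, 0))).unique ?_
      refine (hasDerivAt_mulVec (S τ) (hvd η τ)).neg.congr_deriv ?_ |>.congr_of_eventuallyEq
        (Eventually.of_forall fun y => hNv y τ hτ)
      rw [Matrix.mulVec_neg, neg_neg]
    · rw [order1_eq_zero_iff (y := (η, τ)) hSO]
      simp only [hTN _ η τ hτ, hNv η τ hτ]
      rw [hsyl.apply hSO]
      refine (hasDerivAt_dN (differentiableAt_pd (hws η τ hτ) (1, 0))).unique ?_
      refine ((hasDerivAt_mulVec (S τ) (hwd η τ)).neg.add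
        ((hasDerivAt_mulVec (p τ) (hvd η τ)).add (HasDerivAt.fun_sum (u := Finset.univ)
          fun (i : Fin 2) _ => hasDerivAt_mulVec (q i τ) (hyd i η τ)))).congr_deriv ?_
        |>.congr_of_eventuallyEq (Eventually.of_forall fun y => hNw y τ hτ)
      simp only [hy _ τ hτ η hη, Matrix.mulVec_add, Matrix.mulVec_neg, Finset.sum_neg_distrib]
      abel
  · rw [hNv 0 O hO, hv0]
  · have hPO : (⟨p O, fun i => q i O⟩ : TanOp N) = P :=
      (existsUnique_sylvesterCoeffs sys (hWev O hO).1.1.2).unique (hWev O hO).1.2.1 hP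
    rw [hNw 0 O hO, hw0, hv0, ← hPO]
    simp [TanOp.app, hΨ, flow_zero, hx₀]

/-- The families with prescribed boundary values `φ` determine both tangential operators, because
these are determined by their action on all smooth `φ`. -/
lemma isDifferentialPart_iff {sys : SecondOrderSystem N} {S : Tan → Mat N} {O : Tan}
    (hsys : sys.SmoothAt O) (hS : SmoothMatAt S O)
    (hSA : ∀ᶠ τ in 𝓝 O, S τ * S τ * sys.A τ = 1 ∧ HasSimplePosSpectrum (S τ)) {P₁ P₀ : TanOp N} :
    IsDifferentialPart sys O P₁ P₀ ↔
      P₁ = TanOp.ofMat (-S O) ∧ SylvesterCoeffs sys S O P₀ := by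
  constructor
  · intro h
    obtain ⟨P, hP, -⟩ := existsUnique_sylvesterCoeffs sys hSA.self_of_nhds.2
    have key : ∀ φ : Tan → Vec N, ContDiff ℝ ∞ φ →
        P₁.app φ O = (TanOp.ofMat (-S O)).app φ O ∧ P₀.app φ O = P.app φ O := by
      intro φ hφ
      obtain ⟨W, U, v, w, hW, hO, hexp, hsol, hv, hw, hNv, hNw⟩ :=
        exists_outgoing_solution hsys hS hSA hP hφ
      obtain ⟨h1, h2⟩ := (hexp.tendsto_symbol_iff one_pos hW hO P₁ P₀).1
        (h 1 W U v w one_pos hW hO hexp hsol)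
      simp only [hv, hw, hNv, hNw] at h1 h2
      have h3 : P₁.app (fun _ => (0 : Vec N)) O = 0 := by simp [TanOp.app]
      rw [h3, zero_sub, neg_add_eq_zero] at h2
      rw [TanOp.app_ofMat, Matrix.neg_mulVec]
      exact ⟨sub_eq_zero.1 h1, h2.symm⟩
    have hP0 : P₀ = P := TanOp.app_injective fun φ hφ => (key φ hφ).2
    exact ⟨TanOp.app_injective fun φ hφ => (key φ hφ).1, hP0 ▸ hP⟩
  · rintro ⟨rfl, hP⟩
    exact isDifferentialPart_of_sylvesterCoeffs hsys hS hSA hP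

/-! ### The Laplace transform in time -/

/-- The Laplace transform of `f` converges absolutely at `s` and has the value `F`. -/
def HasLaplace (f : ℝ → Vec N) (s : ℝ) (F : Vec N) : Prop :=
  IntegrableOn (fun t => Real.exp (-(s * t)) • f t) (Ioi 0) ∧ laplace f s = F

namespace HasLaplace

variable {f g : ℝ → Vec N} {s : ℝ} {F G : Vec N}

lemma add (hf : HasLaplace f s F) (hg : HasLaplace g s G) :
    HasLaplace (fun t => f t + g t) s (F + G) := by
  refine ⟨(hf.1.add hg.1).congr (Eventually.of_forall fun t => (smul_add _ _ _).symm), ?_⟩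
  rw [← hf.2, ← hg.2]
  simp only [laplace, smul_add]
  exact integral_add hf.1 hg.1

lemma mulVec (M : Mat N) (hf : HasLaplace f s F) : HasLaplace (fun t => M *ᵥ f t) s (M *ᵥ F) := by
  let T : Vec N →L[ℝ] Vec N := LinearMap.toContinuousLinearMap (Matrix.mulVecLin M)
  have h : ∀ t, Real.exp (-(s * t)) • M *ᵥ f t = T (Real.exp (-(s * t)) • f t) := fun t => by
    rw [map_smul]; rfl
  refine ⟨?_, ?_⟩
  · simp only [h]
    exact T.integrable_comp hf.1
  · rw [← hf.2]
    simp only [laplace, h]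
    exact T.integral_comp_comm hf.1

lemma neg (hf : HasLaplace f s F) : HasLaplace (fun t => -f t) s (-F) := by
  simpa [Matrix.neg_mulVec] using hf.mulVec (-1)

lemma zero : HasLaplace (fun _ => (0 : Vec N)) s 0 := by
  refine ⟨by simp [IntegrableOn], by simp [laplace]⟩

lemma sum {ι : Type*} {J : Finset ι} {f : ι → ℝ → Vec N} {F : ι → Vec N}
    (h : ∀ i, HasLaplace (f i) s (F i)) : HasLaplace (fun t => ∑ i ∈ J, f i t) s (∑ i ∈ J, F i) := by
  classical
  induction J using Finset.induction_on with
  | empty => simpa using zero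
  | insert i J hi ih => simpa only [Finset.sum_insert hi] using (h i).add ih

lemma congr (hf : HasLaplace f s F) (h : ∀ t, 0 < t → f t = g t) : HasLaplace g s F := by
  have h' : EqOn (fun t => Real.exp (-(s * t)) • f t) (fun t => Real.exp (-(s * t)) • g t)
      (Ioi 0) := fun t ht => by simp only [h t ht]
  refine ⟨hf.1.congr_fun h' measurableSet_Ioi, ?_⟩
  rw [← hf.2]
  exact (setIntegral_congr_fun measurableSet_Ioi h').symm

end HasLaplace

lemma integrableOn_exp_smul {Y : Type*} [NormedAddCommGroup Y] [NormedSpace ℝ Y]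
    {f : ℝ → Y} {K s₀ s : ℝ} (hf : Continuous f)
    (hK : ∀ t, 0 ≤ t → ‖f t‖ ≤ K * Real.exp (s₀ * t)) (hs : s₀ < s) :
    IntegrableOn (fun t => Real.exp (-(s * t)) • f t) (Ioi 0) := by
  have h1 : IntegrableOn (fun t => K * Real.exp ((s₀ - s) * t)) (Ioi 0) :=
    (integrableOn_exp_mul_Ioi (by linarith) 0).const_mul K
  refine Integrable.mono' h1 (by fun_prop) ?_
  filter_upwards [ae_restrict_mem measurableSet_Ioi] with t ht
  rw [norm_smul, Real.norm_of_nonneg (Real.exp_pos _).le]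
  calc Real.exp (-(s * t)) * ‖f t‖ ≤ Real.exp (-(s * t)) * (K * Real.exp (s₀ * t)) :=
        mul_le_mul_of_nonneg_left (hK t (le_of_lt ht)) (Real.exp_pos _).le
    _ = K * Real.exp ((s₀ - s) * t) := by
        rw [mul_left_comm, ← Real.exp_add]
        congr 2
        ring

/-- Integration by parts in the Laplace integral. -/
lemma laplace_deriv {f f' : ℝ → Vec N} {K s₀ s : ℝ} (hd : ∀ t, HasDerivAt f (f' t) t)
    (hf' : Continuous f') (hK : ∀ t, 0 ≤ t → ‖f t‖ ≤ K * Real.exp (s₀ * t))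
    (hK' : ∀ t, 0 ≤ t → ‖f' t‖ ≤ K * Real.exp (s₀ * t)) (hs : s₀ < s) :
    laplace f' s = s • laplace f s - f 0 := by
  have hf : Continuous f := continuous_iff_continuousAt.2 fun t => (hd t).continuousAt
  have h1 := integrableOn_exp_smul hf hK hs
  have h2 := integrableOn_exp_smul hf' hK' hs
  have h3 : ∀ t ∈ Ici (0 : ℝ), HasDerivAt (fun t => Real.exp (-(s * t)) • f t)
      (Real.exp (-(s * t)) • f' t - s • Real.exp (-(s * t)) • f t) t := fun t _ => by
    have he : HasDerivAt (fun t => Real.exp (-(s * t))) (Real.exp (-(s * t)) * (-(s * 1))) t :=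
      ((hasDerivAt_id t).const_mul s).neg.exp
    refine (he.smul (hd t)).congr_deriv ?_
    rw [smul_smul, sub_eq_add_neg, ← neg_smul]
    congr 2
    ring
  have h4 : Tendsto (fun t => Real.exp (-(s * t)) • f t) atTop (𝓝 0) := by
    have h5 : Tendsto (fun t => K * Real.exp (-((s - s₀) * t))) atTop (𝓝 0) := by
      have := (Real.tendsto_exp_neg_atTop_nhds_zero.comp
        (tendsto_id.const_mul_atTop (sub_pos.2 hs))).const_mul K
      simpa using this
    refine squeeze_zero_norm' ?_ h5
    filter_upwards [eventually_ge_atTop 0] with t ht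
    rw [norm_smul, Real.norm_of_nonneg (Real.exp_pos _).le]
    calc Real.exp (-(s * t)) * ‖f t‖ ≤ Real.exp (-(s * t)) * (K * Real.exp (s₀ * t)) :=
          mul_le_mul_of_nonneg_left (hK t ht) (Real.exp_pos _).le
      _ = K * Real.exp (-((s - s₀) * t)) := by
          rw [mul_left_comm, ← Real.exp_add]
          congr 2
          ring
  have h6 := integral_Ioi_of_hasDerivAt_of_tendsto' h3 (h2.sub (h1.smul s)) h4
  have h8 : ∫ t in Ioi 0, (Real.exp (-(s * t)) • f' t - s • Real.exp (-(s * t)) • f t) =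
      (∫ t in Ioi 0, Real.exp (-(s * t)) • f' t) - ∫ t in Ioi 0, s • Real.exp (-(s * t)) • f t :=
    integral_sub h2 (h1.smul s)
  rw [h8] at h6
  have h7 := integral_smul (μ := volume.restrict (Ioi 0)) s
    (fun t => Real.exp (-(s * t)) • f t)
  simp only [mul_zero, neg_zero, Real.exp_zero, one_smul, zero_sub] at h6
  rw [laplace, laplace, ← h7, sub_eq_iff_eq_add.1 h6]
  abel

/-- A function of `(t, x)` that is `C¹` for `x ∈ V` and grows at most like `e^{s₀ t}` together with
its derivative. -/
structure ExpBoundedOn (V : Set Loc) (s₀ : ℝ) (g : ℝ × Loc → Vec N) : Prop where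
  contDiffOn : ContDiffOn ℝ 1 g (univ ×ˢ V)
  bound : ∃ K : ℝ, ∀ t : ℝ, 0 ≤ t → ∀ x ∈ V,
    ‖g (t, x)‖ ≤ K * Real.exp (s₀ * t) ∧ ‖fderiv ℝ g (t, x)‖ ≤ K * Real.exp (s₀ * t)

namespace ExpBoundedOn

variable {V : Set Loc} {s₀ s : ℝ} {g : ℝ × Loc → Vec N}

lemma contDiffAt (h : ExpBoundedOn V s₀ g) (hV : IsOpen V) (t : ℝ) {x : Loc} (hx : x ∈ V) :
    ContDiffAt ℝ 1 g (t, x) :=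
  h.contDiffOn.contDiffAt ((isOpen_univ.prod hV).mem_nhds ⟨mem_univ t, hx⟩)

lemma continuous_time (h : ExpBoundedOn V s₀ g) (hV : IsOpen V) {x : Loc} (hx : x ∈ V) :
    Continuous fun t => g (t, x) :=
  continuous_iff_continuousAt.2 fun t =>
    ContinuousAt.comp (g := g) (h.contDiffAt hV t hx).continuousAt
      (Continuous.prodMk_left x).continuousAt

lemma continuous_time_fderiv (h : ExpBoundedOn V s₀ g) (hV : IsOpen V) {x : Loc} (hx : x ∈ V) :
    Continuous fun t => fderiv ℝ g (t, x) :=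
  continuous_iff_continuousAt.2 fun t =>
    ContinuousAt.comp (g := fderiv ℝ g)
      ((h.contDiffAt hV t hx).fderiv_right (m := 0) (by simp)).continuousAt
      (Continuous.prodMk_left x).continuousAt

lemma hasLaplace (h : ExpBoundedOn V s₀ g) (hV : IsOpen V) (hs : s₀ < s) {x : Loc} (hx : x ∈ V) :
    HasLaplace (fun t => g (t, x)) s (laplace (fun t => g (t, x)) s) := by
  obtain ⟨K, hK⟩ := h.bound
  exact ⟨integrableOn_exp_smul (h.continuous_time hV hx) (fun t ht => (hK t ht x hx).1) hs, rfl⟩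

/-- Differentiation under the Laplace integral. -/
lemma hasFDerivAt_laplace (h : ExpBoundedOn V s₀ g) (hV : IsOpen V) (hs : s₀ < s) {x : Loc}
    (hx : x ∈ V) :
    ∃ L : Loc →L[ℝ] Vec N, HasFDerivAt (fun x => laplace (fun t => g (t, x)) s) L x ∧
      ∀ e, HasLaplace (fun t => fderiv ℝ g (t, x) (0, e)) s (L e) := by
  obtain ⟨K, hK⟩ := h.bound
  set D : Loc → ℝ → Loc →L[ℝ] Vec N := fun x t =>
    (fderiv ℝ g (t, x)).comp (ContinuousLinearMap.inr ℝ ℝ Loc) with hD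
  have hDn : ∀ t, 0 ≤ t → ∀ x ∈ V, ‖D x t‖ ≤ K * Real.exp (s₀ * t) := fun t ht x hx => by
    refine ((fderiv ℝ g (t, x)).opNorm_comp_le _).trans ?_
    refine (mul_le_of_le_one_right (norm_nonneg _) ?_).trans (hK t ht x hx).2
    exact ContinuousLinearMap.norm_inr_le_one ℝ ℝ Loc
  have hDc : Continuous (D x) :=
    (h.continuous_time_fderiv hV hx).clm_comp continuous_const
  have hDi := integrableOn_exp_smul hDc (fun t ht => hDn t ht x hx) hs
  have hder := hasFDerivAt_integral_of_dominated_of_fderiv_le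
    (μ := volume.restrict (Ioi (0 : ℝ))) (s := V) (x₀ := x)
    (F := fun x t => Real.exp (-(s * t)) • g (t, x))
    (F' := fun x t => Real.exp (-(s * t)) • D x t)
    (bound := fun t => Real.exp (-(s * t)) • (K * Real.exp (s₀ * t))) (hV.mem_nhds hx) ?_
    (h.hasLaplace hV hs hx).1 hDi.aestronglyMeasurable ?_ ?_ ?_
  · refine ⟨_, hder, fun e => ⟨?_, ?_⟩⟩
    · exact ((ContinuousLinearMap.apply ℝ (Vec N) e).integrable_comp hDi).congr
        (Eventually.of_forall fun t => by simp [hD])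
    · rw [← ContinuousLinearMap.apply_apply (𝕜 := ℝ) e (∫ t in Ioi 0, Real.exp (-(s * t)) • D x t),
        ← ContinuousLinearMap.integral_comp_comm _ hDi]
      simp [hD, laplace]
  · filter_upwards [hV.mem_nhds hx] with y hy
    exact (h.hasLaplace hV hs hy).1.aestronglyMeasurable
  · filter_upwards [ae_restrict_mem measurableSet_Ioi] with t ht y hy
    rw [norm_smul, Real.norm_of_nonneg (Real.exp_pos _).le]
    exact mul_le_mul_of_nonneg_left (hDn t (le_of_lt ht) y hy) (Real.exp_pos _).le
  · have hc : Continuous fun t : ℝ => K * Real.exp (s₀ * t) := by fun_prop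
    exact integrableOn_exp_smul (K := |K|) hc (fun t _ => by
      rw [norm_mul, Real.norm_eq_abs, Real.norm_of_nonneg (Real.exp_pos _).le]) hs
  · refine Eventually.of_forall fun t y hy => ?_
    exact (((((h.contDiffAt hV t hy).differentiableAt (by simp)).hasFDerivAt).comp y
      (hasFDerivAt_prodMk_right t y)).const_smul (Real.exp (-(s * t))))

lemma hasLaplace_pd (h : ExpBoundedOn V s₀ g) (hV : IsOpen V) (hs : s₀ < s) {x : Loc}
    (hx : x ∈ V) (e : Loc) : HasLaplace (fun t => fderiv ℝ g (t, x) (0, e)) s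
      (pd e (fun x => laplace (fun t => g (t, x)) s) x) := by
  obtain ⟨L, hL, hLe⟩ := h.hasFDerivAt_laplace hV hs hx
  rw [pd, hL.fderiv]
  exact hLe e

lemma hasLaplace_time (h : ExpBoundedOn V s₀ g) (hV : IsOpen V) (hs : s₀ < s) {x : Loc}
    (hx : x ∈ V) : HasLaplace (fun t => fderiv ℝ g (t, x) (1, 0)) s
      (s • laplace (fun t => g (t, x)) s - g (0, x)) := by
  obtain ⟨K, hK⟩ := h.bound
  have hc : Continuous fun t => fderiv ℝ g (t, x) (1, 0) :=
    (h.continuous_time_fderiv hV hx).clm_apply continuous_const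
  have hb : ∀ t, 0 ≤ t → ‖fderiv ℝ g (t, x) (1, 0)‖ ≤ K * Real.exp (s₀ * t) := fun t ht => by
    refine ((fderiv ℝ g (t, x)).le_opNorm _).trans ?_
    simpa [Prod.norm_def] using (hK t ht x hx).2
  refine ⟨integrableOn_exp_smul hc hb hs,
    laplace_deriv (fun t => ?_) hc (fun t ht => (hK t ht x hx).1) hb hs⟩
  refine (((h.contDiffAt hV t hx).differentiableAt (by simp)).hasFDerivAt.comp t
    (hasFDerivAt_prodMk_left t x)).hasDerivAt.congr_deriv ?_
  simp

end ExpBoundedOn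

section TimeDomain

/-! ### Solutions in the time domain -/

variable {sys : SecondOrderSystem N} {δ : ℝ} {W : Set Tan} {u : ℝ → Loc → Vec N}

/-- A solution and its first derivatives are exponentially bounded with a common rate. -/
lemma IsTimeSolution.exists_expBoundedOn (h : IsTimeSolution sys δ W u) (hW : IsOpen W) :
    ∃ s₀, ExpBoundedOn (Ioo (-δ) δ ×ˢ W) s₀ (fun z : ℝ × Loc => u z.1 z.2) ∧
      ∀ e, ExpBoundedOn (Ioo (-δ) δ ×ˢ W) s₀
        (fun z => fderiv ℝ (fun z : ℝ × Loc => u z.1 z.2) z e) := by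
  obtain ⟨K, s₀, hK⟩ := h.growth
  have hopen : IsOpen (univ ×ˢ (Ioo (-δ) δ ×ˢ W) : Set (ℝ × Loc)) :=
    isOpen_univ.prod (isOpen_Ioo.prod hW)
  set g : ℝ × Loc → Vec N := fun z => u z.1 z.2 with hg
  have hd : ContDiffOn ℝ 1 (fderiv ℝ g) (univ ×ˢ (Ioo (-δ) δ ×ˢ W)) :=
    h.smooth.fderiv_of_isOpen hopen (by norm_num)
  refine ⟨s₀, ⟨h.smooth.of_le (by norm_num), K, fun t ht x hx => ⟨?_, ?_⟩⟩,
    fun e => ⟨hd.clm_apply contDiffOn_const, K * ‖e‖, fun t ht x hx => ⟨?_, ?_⟩⟩⟩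
  · simpa [norm_iteratedFDeriv_zero] using hK t ht x hx 0 (by norm_num)
  · simpa [norm_iteratedFDeriv_one] using hK t ht x hx 1 (by norm_num)
  · have h1 : ‖fderiv ℝ g (t, x)‖ ≤ K * Real.exp (s₀ * t) := by
      simpa [norm_iteratedFDeriv_one] using hK t ht x hx 1 (by norm_num)
    calc ‖fderiv ℝ g (t, x) e‖ ≤ ‖fderiv ℝ g (t, x)‖ * ‖e‖ := ContinuousLinearMap.le_opNorm _ _
      _ ≤ K * Real.exp (s₀ * t) * ‖e‖ := by gcongr
      _ = K * ‖e‖ * Real.exp (s₀ * t) := by ring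
  · have h2 : ‖fderiv ℝ (fderiv ℝ g) (t, x)‖ ≤ K * Real.exp (s₀ * t) := by
      have := hK t ht x hx 2 le_rfl
      rwa [← norm_iteratedFDeriv_fderiv (n := 1), norm_iteratedFDeriv_one] at this
    have hdx : DifferentiableAt ℝ (fderiv ℝ g) (t, x) :=
      (hd.contDiffAt (hopen.mem_nhds ⟨mem_univ t, hx⟩)).differentiableAt (by simp)
    have h3 : fderiv ℝ (fun z => fderiv ℝ g z e) (t, x) =
        (ContinuousLinearMap.apply ℝ (Vec N) e).comp (fderiv ℝ (fderiv ℝ g) (t, x)) :=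
      ((ContinuousLinearMap.apply ℝ (Vec N) e).hasFDerivAt.comp (t, x) hdx.hasFDerivAt).fderiv
    rw [h3]
    refine ContinuousLinearMap.opNorm_le_bound _ ?_ fun z => ?_
    · have h4 : 0 ≤ K * Real.exp (s₀ * t) :=
        (norm_nonneg (iteratedFDeriv ℝ 0 g (t, x))).trans (hK t ht x hx 0 (by norm_num))
      rw [mul_right_comm]
      exact mul_nonneg h4 (norm_nonneg e)
    · have h4 : ‖fderiv ℝ (fderiv ℝ g) (t, x) z e‖ ≤ ‖fderiv ℝ (fderiv ℝ g) (t, x)‖ * ‖z‖ * ‖e‖ :=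
        ContinuousLinearMap.le_opNorm₂ _ _ _
      refine h4.trans ?_
      calc ‖fderiv ℝ (fderiv ℝ g) (t, x)‖ * ‖z‖ * ‖e‖ ≤ K * Real.exp (s₀ * t) * ‖z‖ * ‖e‖ := by
            gcongr
        _ = K * ‖e‖ * Real.exp (s₀ * t) * ‖z‖ := by ring

lemma pd_slice_time {g : ℝ × Loc → Vec N} {t : ℝ} {x : Loc} (hg : DifferentiableAt ℝ g (t, x))
    (e : Loc) : pd e (fun x => g (t, x)) x = fderiv ℝ g (t, x) (0, e) := by
  have := (hg.hasFDerivAt.comp x (hasFDerivAt_prodMk_right t x)).fderiv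
  change fderiv ℝ (g ∘ fun x => (t, x)) x e = _
  rw [this]
  simp

lemma hasDerivAt_slice_time {g : ℝ × Loc → Vec N} {t : ℝ} {x : Loc}
    (hg : DifferentiableAt ℝ g (t, x)) :
    HasDerivAt (fun t => g (t, x)) (fderiv ℝ g (t, x) (1, 0)) t := by
  refine (hg.hasFDerivAt.comp t (hasFDerivAt_prodMk_left t x)).hasDerivAt.congr_deriv ?_
  simp

/-- The Laplace transform commutes with the derivatives in `(n, τ)` up to second order and turns
`∂_t²` into `s²`, so it maps solutions at rest for `t = 0` to exact solutions of the transformed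
system. -/
lemma IsTimeSolution.exists_laplace (h : IsTimeSolution sys δ W u) (hW : IsOpen W) :
    ∃ s₀ : ℝ, ∀ s, s₀ < s →
      (∀ x ∈ Ioo (-δ) δ ×ˢ W, DifferentiableAt ℝ (fun x => laplace (fun t => u t x) s) x) ∧
      (∀ x ∈ Ioo (-δ) δ ×ˢ W, ∀ t, DifferentiableAt ℝ (u t) x) ∧
      (∀ x ∈ Ioo (-δ) δ ×ˢ W,
        HasLaplace (fun t => u t x) s (laplace (fun t => u t x) s)) ∧
      (∀ x ∈ Ioo (-δ) δ ×ˢ W, ∀ e, HasLaplace (fun t => pd e (u t) x) s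
        (pd e (fun x => laplace (fun t => u t x) s) x)) ∧
      (∀ x ∈ Ico 0 δ ×ˢ W, HasLaplace (fun t => deriv (fun t' => u t' x) t) s
        (s • laplace (fun t => u t x) s)) ∧
      ∀ x ∈ Ico 0 δ ×ˢ W, sys.laplaceOp s (fun x => laplace (fun t => u t x) s) x = 0 := by
  obtain ⟨s₀, hb, hb'⟩ := h.exists_expBoundedOn hW
  set V : Set Loc := Ioo (-δ) δ ×ˢ W with hV_def
  have hV : IsOpen V := isOpen_Ioo.prod hW
  set g : ℝ × Loc → Vec N := fun z => u z.1 z.2 with hg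
  refine ⟨s₀, fun s hs => ?_⟩
  have hgd : ∀ t, ∀ x ∈ V, DifferentiableAt ℝ g (t, x) := fun t x hx =>
    (hb.contDiffAt hV t hx).differentiableAt (by simp)
  have hgd' : ∀ e t, ∀ x ∈ V, DifferentiableAt ℝ (fun z => fderiv ℝ g z e) (t, x) :=
    fun e t x hx => ((hb' e).contDiffAt hV t hx).differentiableAt (by simp)
  have hpd : ∀ e t, ∀ x ∈ V, pd e (u t) x = fderiv ℝ g (t, x) (0, e) := fun e t x hx =>
    pd_slice_time (hgd t x hx) e
  have hpdpd : ∀ e e' t, ∀ x ∈ V, pd e (pd e' (u t)) x =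
      fderiv ℝ (fun z => fderiv ℝ g z (0, e')) (t, x) (0, e) := by
    intro e e' t x hx
    have h1 : pd e' (u t) =ᶠ[𝓝 x] fun x => fderiv ℝ g (t, x) (0, e') := by
      filter_upwards [hV.mem_nhds hx] with y hy using hpd e' t y hy
    rw [pd_eventuallyEq h1]
    exact pd_slice_time (hgd' (0, e') t x hx) e
  have hL0 : ∀ x ∈ V, HasLaplace (fun t => u t x) s (laplace (fun t => u t x) s) := fun x hx =>
    hb.hasLaplace hV hs hx
  have hL1 : ∀ x ∈ V, ∀ e, HasLaplace (fun t => pd e (u t) x) s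
      (pd e (fun x => laplace (fun t => u t x) s) x) := fun x hx e =>
    (hb.hasLaplace_pd hV hs hx e).congr fun t _ => (hpd e t x hx).symm
  have hL2 : ∀ x ∈ V, ∀ e e', HasLaplace (fun t => pd e (pd e' (u t)) x) s
      (pd e (pd e' (fun x => laplace (fun t => u t x) s)) x) := by
    intro x hx e e'
    have h1 : pd e' (fun x => laplace (fun t => u t x) s) =ᶠ[𝓝 x]
        fun x => laplace (fun t => fderiv ℝ g (t, x) (0, e')) s := by
      filter_upwards [hV.mem_nhds hx] with y hy
      exact (hb.hasLaplace_pd hV hs hy e').2.symm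
    rw [pd_eventuallyEq h1]
    exact ((hb' (0, e')).hasLaplace_pd hV hs hx e).congr fun t _ => (hpdpd e e' t x hx).symm
  have hsub : ∀ x ∈ Ico 0 δ ×ˢ W, x ∈ V := fun x hx =>
    ⟨⟨by have := hx.1.1; have := hx.1.2; linarith, hx.1.2⟩, hx.2⟩
  have hT1 : ∀ t, ∀ x ∈ V, deriv (fun t' => u t' x) t = fderiv ℝ g (t, x) (1, 0) := fun t x hx =>
    (hasDerivAt_slice_time (hgd t x hx)).deriv
  have hT2 : ∀ t, ∀ x ∈ V, iteratedDeriv 2 (fun t' => u t' x) t =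
      fderiv ℝ (fun z => fderiv ℝ g z (1, 0)) (t, x) (1, 0) := by
    intro t x hx
    have h1 : deriv (fun t' => u t' x) = fun t => fderiv ℝ g (t, x) (1, 0) :=
      funext fun t => hT1 t x hx
    rw [iteratedDeriv_succ, iteratedDeriv_one, h1]
    exact (hasDerivAt_slice_time (hgd' (1, 0) t x hx)).deriv
  have hLt : ∀ x ∈ Ico 0 δ ×ˢ W, HasLaplace (fun t => deriv (fun t' => u t' x) t) s
      (s • laplace (fun t => u t x) s) := by
    intro x hx
    have h1 := (hb.hasLaplace_time hV hs (hsub x hx)).congr fun t _ => (hT1 t x (hsub x hx)).symm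
    simp only [hg, (h.rest x hx).1, sub_zero] at h1
    exact h1
  refine ⟨fun x hx => ?_, fun x hx t => ?_, hL0, hL1, hLt, fun x hx => ?_⟩
  · obtain ⟨L, hL, -⟩ := hb.hasFDerivAt_laplace hV hs hx
    exact hL.differentiableAt
  · exact ((hgd t x hx).hasFDerivAt.comp x (hasFDerivAt_prodMk_right t x)).differentiableAt
  · have hx' := hsub x hx
    have hLtt : HasLaplace (fun t => iteratedDeriv 2 (fun t' => u t' x) t) s
        (s ^ 2 • laplace (fun t => u t x) s) := by
      have h1 := ((hb' (1, 0)).hasLaplace_time hV hs hx').congr fun t _ => (hT2 t x hx').symm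
      have h2 : laplace (fun t => fderiv ℝ g (t, x) (1, 0)) s = s • laplace (fun t => u t x) s := by
        rw [← (hLt x hx).2]
        simp only [hT1 _ x hx']
      have h3 : fderiv ℝ g (0, x) (1, 0) = 0 := by
        rw [← hT1 0 x hx']
        exact (h.rest x hx).2
      simp only [h2, h3, sub_zero, smul_smul, ← sq] at h1
      exact h1
    have hsp : HasLaplace (fun t => sys.spatialOp (u t) x) s
        (sys.spatialOp (fun x => laplace (fun t => u t x) s) x) :=
      (((((hL2 x hx' _ _).mulVec _).add (HasLaplace.sum fun i => (hL2 x hx' _ _).mulVec _)).add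
        ((hL1 x hx' _).mulVec _)).add (HasLaplace.sum fun i => HasLaplace.sum fun j =>
          (hL2 x hx' _ _).mulVec _)).add (HasLaplace.sum fun i => (hL1 x hx' _).mulVec _) |>.add
        ((hL0 x hx').mulVec _)
    have h1 := (hLtt.neg.add hsp).congr fun t ht => h.eqn t ht x hx
    exact h1.2.symm.trans HasLaplace.zero.2

lemma spatialOp_const_smul (c : ℝ) (f : Loc → Vec N) (x : Loc) :
    sys.spatialOp (fun x => c • f x) x = c • sys.spatialOp f x := by
  simp only [SecondOrderSystem.spatialOp, dN, dT, pd_const_smul, Matrix.mulVec_smul, smul_add,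
    Finset.smul_sum]

lemma TanOp.app_const_smul (P : TanOp N) (c : ℝ) (φ : Tan → Vec N) (O : Tan) :
    P.app (fun τ => c • φ τ) O = c • P.app φ O := by
  have h : fderiv ℝ (fun τ => c • φ τ) O = c • fderiv ℝ φ O :=
    congrFun (fderiv_const_smul_field (𝕜 := ℝ) (f := φ) c) O
  simp only [TanOp.app, h, _root_.smul_apply, Matrix.mulVec_smul, smul_add, Finset.smul_sum]

/-- The normalized Laplace transform of a solution at rest for `t = 0` is an outgoing family of exact
solutions, so the condition on the boundary symbol applies to it. -/
lemma holdsInTimeDomain_of_isDifferentialPart {O : Tan} {M : Mat N} {P : TanOp N}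
    (hP : IsDifferentialPart sys O (TanOp.ofMat M) P) :
    HoldsInTimeDomain sys O (TanOp.ofMat M) P := by
  intro δ W u σ v w hδ hW hO hu hexp
  obtain ⟨s₀, hs₀⟩ := hu.exists_laplace hW
  have hOx : ((0, O) : Loc) ∈ Ioo (-δ) δ ×ˢ W := ⟨⟨by linarith, hδ⟩, hO⟩
  have hOx' : ((0, O) : Loc) ∈ Ico 0 δ ×ˢ W := ⟨⟨le_rfl, hδ⟩, hO⟩
  have hsol : SolvesUpToFirstOrder sys W (fun s x => σ s • laplace (fun t => u t x) s) := by
    intro η hη τ hτ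
    refine (isLittleO_zero _ _).congr' ?_ EventuallyEq.rfl
    have h1 : ∀ᶠ ε : ℝ in 𝓝[>] 0, s₀ < ε⁻¹ :=
      tendsto_inv_nhdsGT_zero.eventually (eventually_gt_atTop s₀)
    have h2 : Tendsto (fun ε : ℝ => ε * η) (𝓝[>] 0) (𝓝 0) := by
      have : Tendsto (fun ε : ℝ => ε * η) (𝓝 0) (𝓝 (0 * η)) := tendsto_id.mul_const η
      rw [zero_mul] at this
      exact this.mono_left nhdsWithin_le_nhds
    filter_upwards [h1, h2.eventually (eventually_lt_nhds hδ), self_mem_nhdsWithin] with ε h3 h4 hε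
    obtain ⟨-, -, -, -, -, h5⟩ := hs₀ (1 / ε) (by rwa [one_div])
    have h6 := h5 (ε * η, τ) ⟨⟨mul_nonneg (le_of_lt hε) hη, h4⟩, hτ⟩
    have h7 : sys.laplaceOp (1 / ε) (fun x => σ (1 / ε) • laplace (fun t => u t x) (1 / ε))
        (ε * η, τ) = σ (1 / ε) • sys.laplaceOp (1 / ε)
          (fun x => laplace (fun t => u t x) (1 / ε)) (ε * η, τ) := by
      simp only [SecondOrderSystem.laplaceOp, spatialOp_const_smul, smul_add, smul_neg]
      rw [smul_comm]
    rw [h7, h6, smul_zero, smul_zero]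
  have hlap : ∀ s, s₀ < s → HasLaplace (boundaryOp (TanOp.ofMat M) P O u) s
      (s • (TanOp.ofMat M).app (fun τ => laplace (fun t => u t (0, τ)) s) O -
        dN (fun x => laplace (fun t => u t x) s) (0, O) +
        P.app (fun τ => laplace (fun t => u t (0, τ)) s) O) := by
    intro s hs
    obtain ⟨h1, h2, h3, h4, h5, -⟩ := hs₀ s hs
    have h6 := (((h5 _ hOx').mulVec M).add ((h4 _ hOx (1, 0)).neg)).add
      (((h3 _ hOx).mulVec P.p).add (HasLaplace.sum (J := Finset.univ)
        fun i : Fin 2 => (h4 _ hOx (0, tanDir i)).mulVec (P.q i)))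
    rw [TanOp.app_ofMat, P.app_slice (f := fun x => laplace (fun t => u t x) s) (h1 _ hOx),
      sub_eq_add_neg, ← Matrix.mulVec_smul]
    refine h6.congr fun t _ => ?_
    rw [boundaryOp, TanOp.app_ofMat, P.app_slice (h2 _ hOx t), sub_eq_add_neg]
    rfl
  refine ⟨?_, ?_⟩
  · filter_upwards [eventually_gt_atTop s₀] with s hs
    exact (hlap s hs).1
  · refine (hP δ W _ v w hδ hW hO hexp hsol).congr' ?_
    filter_upwards [eventually_gt_atTop s₀] with s hs
    have h1 : dN (fun x => σ s • laplace (fun t => u t x) s) =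
        fun x => σ s • dN (fun x => laplace (fun t => u t x) s) x := pd_const_smul _ _ _
    rw [(hlap s hs).2, TanOp.app_const_smul, TanOp.app_const_smul, h1, smul_add, smul_sub,
      smul_comm s (σ s)]

end TimeDomain

end TBC

/-! ### Existence and uniqueness of the differential part -/

theorem mainTheorem1 {N : ℕ} (sys : TBC.SecondOrderSystem N) (O : TBC.Tan)
    (hsmooth : sys.SmoothAt O) (hhyp : sys.HyperbolicAt O) :
    TBC.PosEigenvalues (sys.A O) ∧
    ∃ S : TBC.Tan → TBC.Mat N, TBC.SmoothMatAt S O ∧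
      (∀ᶠ τ in 𝓝 O, ∀ X : TBC.Mat N, TBC.IsInvSqrt (sys.A τ) X ↔ X = S τ) ∧
      (∃! P₀ : TBC.TanOp N, TBC.SolvesSylvester sys S O P₀) ∧
      (∀ P₁ P₀ : TBC.TanOp N, TBC.IsDifferentialPart sys O P₁ P₀ ↔
        P₁ = TBC.TanOp.ofMat (-S O) ∧ TBC.SolvesSylvester sys S O P₀) ∧
      (∀ P₀ : TBC.TanOp N, TBC.SolvesSylvester sys S O P₀ →
        TBC.HoldsInTimeDomain sys O (TBC.TanOp.ofMat (-S O)) P₀) := by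
  have hA := hhyp.hasSimplePosSpectrum
  obtain ⟨S, hS, hSA⟩ := TBC.exists_smooth_invSqrt hsmooth.1 hA
  refine ⟨hA.posEigenvalues, S, hS, ?_, ?_, fun P₁ P₀ => ?_, fun P₀ hP => ?_⟩
  · filter_upwards [hSA] with τ hτ X
    exact ⟨fun hX => hX.eq hτ.1 hτ.2, fun hX => hX ▸ ⟨hτ.1, hτ.2.posEigenvalues⟩⟩
  · simp only [TBC.solvesSylvester_iff hS]
    exact TBC.existsUnique_sylvesterCoeffs sys hSA.self_of_nhds.2
  · rw [TBC.solvesSylvester_iff hS]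
    exact TBC.isDifferentialPart_iff hsmooth hS hSA
  · rw [TBC.solvesSylvester_iff hS] at hP
    exact TBC.holdsInTimeDomain_of_isDifferentialPart
      (TBC.isDifferentialPart_of_sylvesterCoeffs hsmooth hS hSA hP)
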